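/- **Setting.** Let $G$ be a second countable, locally compact, unimodular (Hausdorff) group with Haar measure $\mu$ and identity $e$. Assume that $G$ has polynomial growth with exponent $D>0$: $G$ is generated by a compact symmetric unit neighborhood $U$ with $\mu(U^n)\le C n^D$ for all $n\ge 1$ and some $C\ge 1$. Let $d$ be a *periodic metric* on $G$, that is, a measurable metric $d:G\times G\to[0,\infty)$ (not required to induce the topology) such that: $d(zx,zy)=d(x,y)$; for every $r$ the set $\{y: d(e,y)\le r\}$ is relatively compact; $d$ is bounded on compact subsets of $G\times G$; and for every $\varepsilon>0$ there is $s>0$ such that any $x,y\in G$ can be joined by points $x=x_1,\dots,x_n=y$ with $\sum_i d(x_i,x_{i+1})\le(1+\varepsilon)d(x,y)$ and $d(x_i,x_{i+1})\le s$ for all $i$. Write $|x|=d(x,e)$ and $B_r=\{x:|x|<r\}$. Assume that $d$ has the $\delta$-annular decay property for some $\delta\in(0,1]$: there is $c>0$ with $$\mu(B_r\setminus B_{r-s})\le c\,(s/r)^\delta\mu(B_r)\qquad\text{for all } r\ge 1,\ 0<s\le r.$$ Let $(\pi,\mathcal H_\pi)$ be a projective discrete series representation of $G$ on a separable complex Hilbert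 space: $\pi$ is a strongly measurable map into the unitary operators with $\pi(x)\pi(y)=\sigma(x,y)\pi(xy)$, $|\sigma(x,y)|=1$, it is irreducible, and $\int_G|\langle h,\pi(x)h\rangle|^2d\mu(x)<\infty$ for some $h\ne0$. Its formal degree is the unique $d_\pi>0$ with $$\int_G \langle f_1,\pi(x)g_1\rangle\langle \pi(x)g_2,f_2\rangle\,d\mu(x)=d_\pi^{-1}\langle f_1,f_2\rangle\overline{\langle g_1,g_2\rangle}\qquad\text{for all } f_1,f_2,g_1,g_2\in\mathcal H_\pi.$$ Let $\alpha>0$. A vector $g\in\mathcal H_\pi$ belongs to $\mathcal D_{\pi,w_\alpha}$ if, for a relatively compact symmetric unit neighborhood $Q$, $$\int_G \sup_{z\in Q}|\langle g,\pi(xz)g\rangle|^2\,(1+|x|)^\alpha\,d\mu(x)<\infty .$$ A sequence of radii $r_n>0$ is called *associated to $d$* if there is $r_0>0$ such that $B_{r_0}$ is a unit neighborhood and $r_{n+1}-r_n>r_0$ for all $n$; $\overline{B_{r_n}}$ denotes the closure of $B_{r_n}$ in $G$. For $\Lambda\subseteq G$, the family $\pi(\Lambda)g=(\pi(\lambda)g)_{\lambda\in\Lambda}$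 is a *frame* with bounds $A,B>0$ if $A\|f\|^2\le\sum_{\lambda\in\Lambda}|\langle f,\pi(\lambda)g\rangle|^2\le B\|f\|^2$ for all $f\in\mathcal H_\pi$, and a *Riesz sequence* with bounds $A,B>0$ if $A\|c\|^2\le\|\sum_{\lambda\in\Lambda}c_\lambda\pi(\lambda)g\|^2\le B\|c\|^2$ for all $c\in\ell^2(\Lambda)$. **Theorem.** Let $g\in\mathcal H_\pi$. (0) If there are $C_0>0$ and $\beta>1-\delta$ with $|\langle g,\pi(x)g\rangle|\le C_0(1+|x|)^{-(D+\alpha+\beta)/2}$ for all $x\in G$, then $g\in\mathcal D_{\pi,w_\alpha}$ (with any choice of $Q$). Suppose that $g\in\mathcal D_{\pi,w_\alpha}$ (with some choice of $Q$), and let $A,B>0$. (i) There is $C>0$, depending only on $g,\alpha,d,A,B$ (and the fixed $G,\mu,\pi$), such that for every sequence $(r_n)$ associated to $d$ there is $N$ such that, whenever $\Lambda\subseteq G$ and $\pi(\Lambda)g$ is a frame with bounds $A,B$, $$\inf_{x\in G}\frac{\#(\Lambda\cap x\overline{B_{r_n}})}{\mu(\overline{B_{r_n}})}\ \ge\ d_\pi\Big(1-C\,r_n^{-\frac{\alpha\delta}{\delta+\alpha}}\Big)\qquad\text{for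 all } n\ge N.$$ (ii) There is $C>0$, depending only on $g,\alpha,d,A,B$ (and the fixed $G,\mu,\pi$), such that for every sequence $(r_n)$ associated to $d$ there is $N$ such that, whenever $\Lambda\subseteq G$ and $\pi(\Lambda)g$ is a Riesz sequence with bounds $A,B$, $$\sup_{x\in G}\frac{\#(\Lambda\cap x\overline{B_{r_n}})}{\mu(\overline{B_{r_n}})}\ \le\ d_\pi\Big(1+C\,r_n^{-\frac{\alpha\delta}{\delta+\alpha}}\Big)\qquad\text{for all } n\ge N.$$ -/

import Mathlib

open MeasureTheory Topology
open scoped Pointwise ENNReal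

namespace CoherentSystem

noncomputable section

/-! ### Projective representations, discrete series and the formal degree -/

/-- A projective unitary representation of `G` on `H`: a strongly measurable map `x ↦ π x` into the
unitary operators of `H` with `π x (π y v) = σ x y • π (x * y) v` for a cocycle `σ : G × G → 𝕋`. -/
structure ProjectiveRep (G : Type*) [Group G] [TopologicalSpace G] [MeasurableSpace G]
    (H : Type*) [NormedAddCommGroup H] [InnerProductSpace ℂ H] where
  /-- the unitary operator attached to a group element -/
  op : G → (H ≃ₗᵢ[ℂ] H)
  /-- the cocycle -/
  σ : G → G → Circle
  op_mul : ∀ (x y : G) (v : H), op x (op y v) = (σ x y : ℂ) • op (x * y) v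
  stronglyMeasurable_op : ∀ v : H, StronglyMeasurable fun x => op x v

section Representation

variable {G : Type*} [Group G] [TopologicalSpace G] [MeasurableSpace G]
  {H : Type*} [NormedAddCommGroup H] [InnerProductSpace ℂ H]

/-- The coefficient transform `V_g f (x) = ⟨f, π(x) g⟩`, where the inner product `⟨·,·⟩` is linear in
its first entry (`inner ℂ` is linear in its second entry). -/
def coeff (π : ProjectiveRep G H) (g f : H) (x : G) : ℂ :=
  inner ℂ (π.op x g) f

/-- The only closed invariant subspaces are `{0}` and the whole space. -/
def IsIrreducible (π : ProjectiveRep G H) : Prop :=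
  ∀ W : Submodule ℂ H, IsClosed (W : Set H) →
    (∀ x : G, ∀ v ∈ W, π.op x v ∈ W) → W = ⊥ ∨ W = ⊤

/-- A projective discrete series representation: irreducible and square-integrable. -/
def IsDiscreteSeries (π : ProjectiveRep G H) (μ : Measure G) : Prop :=
  IsIrreducible π ∧ ∃ g : H, g ≠ 0 ∧ Integrable (fun x => ‖coeff π g g x‖ ^ 2) μ

/-- The orthogonality relations with constant `dπ > 0`:
`∫ ⟨f₁, π(x) g₁⟩ ⟨π(x) g₂, f₂⟩ dμ(x) = dπ⁻¹ ⟨f₁, f₂⟩ conj ⟨g₁, g₂⟩`. -/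
def IsFormalDegree (π : ProjectiveRep G H) (μ : Measure G) (dπ : ℝ) : Prop :=
  0 < dπ ∧ ∀ f₁ f₂ g₁ g₂ : H,
    ∫ x, coeff π g₁ f₁ x * star (coeff π g₂ f₂ x) ∂μ
      = ((dπ : ℂ))⁻¹ * inner ℂ f₂ f₁ * star (inner ℂ g₂ g₁)

open Classical in
/-- The formal degree of `π`: the number `dπ > 0` for which the orthogonality relations hold.
Every projective discrete series representation of a unimodular group has exactly one; the value `0`
is only assigned to representations that have none. -/
def formalDegree (π : ProjectiveRep G H) (μ : Measure G) : ℝ :=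
  if h : ∃ dπ : ℝ, IsFormalDegree π μ dπ then h.choose else 0

/-- `π(Λ) g`, a family indexed by `Λ`, is a frame for `H` with frame bounds `A` and `B`. -/
def IsFrame (π : ProjectiveRep G H) (g : H) (Λ : Set G) (A B : ℝ) : Prop :=
  ∀ f : H, Summable (fun l : Λ => ‖coeff π g f (l : G)‖ ^ 2) ∧
    A * ‖f‖ ^ 2 ≤ ∑' l : Λ, ‖coeff π g f (l : G)‖ ^ 2 ∧
    ∑' l : Λ, ‖coeff π g f (l : G)‖ ^ 2 ≤ B * ‖f‖ ^ 2

/-- `π(Λ) g`, a family indexed by `Λ`, is a Riesz sequence in `H` with Riesz bounds `A` and `B`. -/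
def IsRieszSequence (π : ProjectiveRep G H) (g : H) (Λ : Set G) (A B : ℝ) : Prop :=
  ∀ c : lp (fun _ : Λ => ℂ) 2, Summable (fun l : Λ => c l • π.op (l : G) g) ∧
    A * ‖c‖ ^ 2 ≤ ‖∑' l : Λ, c l • π.op (l : G) g‖ ^ 2 ∧
    ‖∑' l : Λ, c l • π.op (l : G) g‖ ^ 2 ≤ B * ‖c‖ ^ 2

/-- `Q` is a relatively compact symmetric unit neighborhood. -/
def IsAdmissibleNhd (Q : Set G) : Prop :=
  Q ∈ 𝓝 (1 : G) ∧ IsCompact (closure Q) ∧ Q⁻¹ = Q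

/-- The local maximal function `M_Q F (x) = sup_{z ∈ Q} |F (x z)|`. -/
def localMax (Q : Set G) (F : G → ℂ) (x : G) : ℝ≥0∞ :=
  ⨆ z ∈ Q, ‖F (x * z)‖ₑ

/-- The set `𝓓_{π,w}` of vectors `g` with `M_Q V_g g ∈ L²_w(G)`, for a weight `w ≥ 1`, where the
local maximal function is formed with the unit neighborhood `Q`. -/
def localizedVectors (π : ProjectiveRep G H) (μ : Measure G) (Q : Set G) (w : G → ℝ) : Set H :=
  {g | ∫⁻ x, localMax Q (coeff π g g) x ^ 2 * ENNReal.ofReal (w x) ∂μ < ⊤}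

end Representation

/-! ### Polynomial growth and periodic metrics -/

section Metric

variable {G : Type*} [Group G] [TopologicalSpace G] [MeasurableSpace G]

/-- `G` is generated by a compact symmetric unit neighborhood `U` with `μ(Uⁿ) ≤ C n^D` for all
`n ≥ 1`. -/
def HasPolynomialGrowth (μ : Measure G) (D : ℝ) : Prop :=
  0 < D ∧ ∃ U : Set G, IsCompact U ∧ U ∈ 𝓝 (1 : G) ∧ U⁻¹ = U ∧ Subgroup.closure U = ⊤ ∧
    ∃ C : ℝ, 1 ≤ C ∧ ∀ n : ℕ, 1 ≤ n → μ (U ^ n) ≤ ENNReal.ofReal (C * (n : ℝ) ^ D)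

/-- A periodic metric on `G`: a measurable metric (not required to induce the topology) which is
left-invariant, metrically proper, locally bounded and asymptotically geodesic. -/
structure IsPeriodicMetric (d : G → G → ℝ) : Prop where
  nonneg : ∀ x y, 0 ≤ d x y
  eq_zero_iff : ∀ x y, d x y = 0 ↔ x = y
  symm : ∀ x y, d x y = d y x
  triangle : ∀ x y z, d x z ≤ d x y + d y z
  measurable : Measurable fun p : G × G => d p.1 p.2
  left_invariant : ∀ x y z, d (z * x) (z * y) = d x y
  /-- preimages of bounded sets under `y ↦ d e y` are relatively compact -/
  proper : ∀ r : ℝ, IsCompact (closure {y : G | d 1 y ≤ r})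
  locally_bounded : ∀ K : Set (G × G), IsCompact K → BddAbove ((fun p : G × G => d p.1 p.2) '' K)
  asymptotically_geodesic : ∀ ε : ℝ, 0 < ε → ∃ s : ℝ, 0 < s ∧ ∀ x y : G,
    ∃ (n : ℕ) (p : ℕ → G), p 0 = x ∧ p n = y ∧
      ∑ i ∈ Finset.range n, d (p i) (p (i + 1)) ≤ (1 + ε) * d x y ∧
      ∀ i < n, d (p i) (p (i + 1)) ≤ s

/-- The open ball `B_r = {x | d x e < r}`. -/
def oball (d : G → G → ℝ) (r : ℝ) : Set G :=
  {x | d x 1 < r}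

/-- The `δ`-annular decay property. -/
def AnnularDecay (μ : Measure G) (d : G → G → ℝ) (δ : ℝ) : Prop :=
  0 < δ ∧ δ ≤ 1 ∧ ∃ c : ℝ, 0 < c ∧ ∀ r s : ℝ, 1 ≤ r → 0 < s → s ≤ r →
    μ (oball d r \ oball d (r - s)) ≤ ENNReal.ofReal (c * (s / r) ^ δ) * μ (oball d r)

/-- The radii `r n > 0` of a strong Følner exhaustion sequence `closure (B_{r n})` associated to `d`:
consecutive radii differ by more than some `r₀ > 0` for which `B_{r₀}` is a unit neighborhood. -/
def IsAssociatedRadii (d : G → G → ℝ) (r : ℕ → ℝ) : Prop :=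
  (∀ n, 0 < r n) ∧ ∃ r₀ : ℝ, 0 < r₀ ∧ oball d r₀ ∈ 𝓝 (1 : G) ∧ ∀ n, r₀ < r (n + 1) - r n

/-- The polynomial weight `w_α (x) = (1 + |x|)^α`, where `|x| = d x e`. -/
def polyWeight (d : G → G → ℝ) (α : ℝ) (x : G) : ℝ :=
  (1 + d x 1) ^ α

/-- The ratio `#(Λ ∩ xK) / μ(K)`. -/
def countingRatio (μ : Measure G) (Λ K : Set G) (x : G) : ℝ≥0∞ :=
  ((Λ ∩ x • K).encard : ℝ≥0∞) / μ K

end Metric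

end

end CoherentSystem

namespace CoherentSystem

/-! ### Phases of projective representations -/

section Phases

variable {G : Type*} [Group G] [TopologicalSpace G] [MeasurableSpace G]
  {H : Type*} [NormedAddCommGroup H] [InnerProductSpace ℂ H]

/-! The proof compares dimension with volume. If `P` projects onto a finite-dimensional `W`,
orthogonality gives ∫ ‖P π(x) g‖² dμ(x) = dπ⁻¹ ‖g‖² dim W, so bounds on the integrand relate dim W
to the measure of a ball.

For a frame, `W` is spanned by the canonical dual vectors of the points in a ball of radius R
(`IsFrame.exists_subspace`). If t lies at depth s inside the ball, rebuilding π(t) g from these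
points loses only coefficients at distance at least s from t, and the weighted local maximal
function bounds their square sum by a multiple of s^(-α). So the integrand is at least ‖g‖² (1 - C
s^(-α)) on a ball of radius R - s (`exists_frame_card_bound`). For a Riesz sequence, `W` is the span
of the vectors in the ball; the integrand is at most ‖g‖² within radius R + s and beyond it is
dominated by tails of |V_g g|², each of integral O(s^(-α)) (`exists_riesz_card_bound`). Annular
decay exchanges the radii at relative cost (s/R)^δ, and s = r^(δ/(δ+α)) balances the two errors.

Orthogonality comes from irreducibility: the graph of V_h is a Hilbert space, and its projection ι
to `H` makes ι ι* commute with π, hence scalar. Inversion invariance of μ interchanges the two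
vectors, and polarization finishes. Part (0) rests on the volume bound O(r^D) for balls, because
asymptotic geodesicity turns distance into word length. -/

lemma ProjectiveRep.op_one (π : ProjectiveRep G H) (v : H) :
    π.op 1 v = (π.σ 1 1 : ℂ) • v := by
  have h := π.op_mul 1 1 v
  rw [mul_one, ← map_smul] at h
  exact (π.op 1).injective h

/-- The cocycle contributes only a unimodular factor, so moduli of coefficients behave as for a
genuine representation. -/
lemma coeff_op_right (π : ProjectiveRep G H) (h f : H) (x y : G) :
    coeff π h (π.op y f) x = (π.σ y (y⁻¹ * x) : ℂ) * coeff π h f (y⁻¹ * x) := by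
  have e := π.op_mul y (y⁻¹ * x) h
  rw [mul_inv_cancel_left] at e
  have e2 : π.op x h = ((π.σ y (y⁻¹ * x))⁻¹ : Circle) • π.op y (π.op (y⁻¹ * x) h) := by
    rw [e, ← Circle.smul_def, smul_smul, inv_mul_cancel, one_smul]
  rw [coeff, e2, Circle.smul_def, inner_smul_left, LinearIsometryEquiv.inner_map_map,
    ← Circle.coe_inv_eq_conj, inv_inv, coeff]

lemma norm_coeff_op_right (π : ProjectiveRep G H) (h f : H) (x y : G) :
    ‖coeff π h (π.op y f) x‖ = ‖coeff π h f (y⁻¹ * x)‖ := by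
  rw [coeff_op_right, norm_mul, Circle.norm_coe, one_mul]

/-- Apply the unitary π(x) to both entries; π(x) π(x⁻¹) is a scalar of modulus one. -/
lemma norm_coeff_swap (π : ProjectiveRep G H) (h f : H) (x : G) :
    ‖coeff π f h x‖ = ‖coeff π h f x⁻¹‖ := by
  have e := π.op_mul x x⁻¹ h
  rw [mul_inv_cancel, π.op_one, smul_smul] at e
  have e2 : ‖inner ℂ (π.op x f) (π.op x (π.op x⁻¹ h))‖ = ‖coeff π f h x‖ := by
    rw [e, inner_smul_right, norm_mul, norm_mul, Circle.norm_coe, Circle.norm_coe, one_mul,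
      one_mul, coeff]
  rw [← e2, LinearIsometryEquiv.inner_map_map, norm_inner_symm, coeff]

lemma coeff_add_right (π : ProjectiveRep G H) (g f f' : H) (x : G) :
    coeff π g (f + f') x = coeff π g f x + coeff π g f' x := inner_add_right _ _ _

lemma coeff_smul_right (π : ProjectiveRep G H) (g f : H) (c : ℂ) (x : G) :
    coeff π g (c • f) x = c * coeff π g f x := inner_smul_right _ _ _

lemma coeff_add_left (π : ProjectiveRep G H) (g g' f : H) (x : G) :
    coeff π (g + g') f x = coeff π g f x + coeff π g' f x := by
  rw [coeff, map_add, inner_add_left]; rfl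

lemma coeff_smul_left (π : ProjectiveRep G H) (g f : H) (c : ℂ) (x : G) :
    coeff π (c • g) f x = star c * coeff π g f x := by
  rw [coeff, map_smul, inner_smul_left]; rfl

lemma stronglyMeasurable_coeff (π : ProjectiveRep G H) (g f : H) :
    StronglyMeasurable (coeff π g f) :=
  (π.stronglyMeasurable_op g).inner stronglyMeasurable_const

end Phases

/-! ### Schur's lemma -/

section Schur

variable {G : Type*} [Group G] [TopologicalSpace G] [MeasurableSpace G]
  {H : Type*} [NormedAddCommGroup H] [InnerProductSpace ℂ H] [CompleteSpace H]

/-- **Schur's lemma** for self-adjoint operators. -/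
theorem IsIrreducible.exists_eq_smul {π : ProjectiveRep G H} (hπ : IsIrreducible π)
    {T : H →L[ℂ] H} (hsa : IsSelfAdjoint T) (hT : ∀ x v, T (π.op x v) = π.op x (T v)) :
    ∃ c : ℝ, ∀ v, T v = (c : ℂ) • v := by
  nontriviality H
  have hcomm : ∀ (f : ℝ → ℝ) x v, cfc f T (π.op x v) = π.op x (cfc f T v) := by
    intro f x v
    have h : Commute T ((π.op x).toContinuousLinearEquiv : H →L[ℂ] H) :=
      ContinuousLinearMap.ext fun v => hT x v
    exact congrArg (fun S : H →L[ℂ] H => S v) (h.cfc_real f).eq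
  obtain ⟨a, ha⟩ := ContinuousFunctionalCalculus.spectrum_nonempty (R := ℝ) T hsa
  -- A second spectral point `b` would give tent functions about `a` and `b` with product zero but
  -- nonzero operators. The kernel of the first operator would be a closed invariant subspace other
  -- than `⊥` and `⊤`.
  have hsub : ∀ b ∈ spectrum ℝ T, b = a := by
    intro b hb
    by_contra hne
    set ε : ℝ := |b - a| / 2
    have hε : 0 < ε := by have := abs_pos.2 (sub_ne_zero.2 hne); positivity
    let φ : ℝ → ℝ → ℝ := fun p t => max 0 (ε - |t - p|)
    have hφc : ∀ p, Continuous (φ p) := fun p => by fun_prop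
    have hφ0 : ∀ p ∈ spectrum ℝ T, cfc (φ p) T ≠ 0 := by
      intro p hp h0
      have h1 : φ p p ∈ spectrum ℝ (cfc (φ p) T) := by
        rw [cfc_map_spectrum (φ p) T (hf := (hφc p).continuousOn)]
        exact ⟨p, hp, rfl⟩
      rw [h0, spectrum.zero_eq] at h1
      simp [φ, hε.ne', hε.le] at h1
    have hmul : cfc (φ a) T * cfc (φ b) T = 0 := by
      rw [← cfc_mul (φ a) (φ b) T (hφc a).continuousOn (hφc b).continuousOn]
      have : (fun t => φ a t * φ b t) = fun _ => 0 := by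
        funext t
        rcases le_total ε |t - a| with h | h
        · simp [φ, h]
        · have : ε ≤ |t - b| := by
            have h2 : |b - a| ≤ |t - a| + |t - b| := by
              rw [abs_sub_comm t b, add_comm]
              exact abs_sub_le _ _ _
            have : |b - a| = 2 * ε := by simp only [ε]; ring
            linarith
          simp [φ, this]
      rw [this]
      simp
    rcases hπ (LinearMap.ker (cfc (φ a) T : H →L[ℂ] H).toLinearMap)
        (ContinuousLinearMap.isClosed_ker (cfc (φ a) T)) (fun x v hv => by
          have hv' : cfc (φ a) T v = 0 := hv
          change cfc (φ a) T (π.op x v) = 0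
          rw [hcomm, hv', map_zero]) with h | h
    · refine hφ0 b hb (ContinuousLinearMap.ext fun v => ?_)
      have h1 : cfc (φ b) T v ∈ LinearMap.ker (cfc (φ a) T : H →L[ℂ] H).toLinearMap :=
        congrArg (fun S : H →L[ℂ] H => S v) hmul
      rw [h] at h1
      simpa using h1
    · refine hφ0 a ha (ContinuousLinearMap.ext fun v => ?_)
      have h1 : v ∈ LinearMap.ker (cfc (φ a) T : H →L[ℂ] H).toLinearMap := by rw [h]; trivial
      simpa using h1
  refine ⟨a, fun v => ?_⟩
  have h1 : cfc (id : ℝ → ℝ) T = cfc (fun _ => a) T := cfc_congr fun b hb => hsub b hb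
  rw [cfc_id ℝ T, cfc_const a T] at h1
  conv_lhs => rw [h1]
  rw [Algebra.algebraMap_eq_smul_one]
  simp

end Schur

/-! ### Square-integrable coefficients and the orthogonality relations -/

section Orthogonality

variable {G : Type*} [Group G] [TopologicalSpace G] [MeasurableSpace G]
  {H : Type*} [NormedAddCommGroup H] [InnerProductSpace ℂ H]

/-- The graph of the (possibly unbounded) coefficient transform `f ↦ V_h f` from `H` to `L²`. -/
def coeffGraph (π : ProjectiveRep G H) (μ : Measure G) (h : H) :
    Submodule ℂ (WithLp 2 (H × Lp ℂ 2 μ)) where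
  carrier := {p | (p.snd : G → ℂ) =ᵐ[μ] coeff π h p.fst}
  zero_mem' := by
    filter_upwards [Lp.coeFn_zero ℂ 2 μ] with x hx
    simpa [coeff] using hx
  add_mem' := by
    intro p q hp hq
    filter_upwards [hp, hq, Lp.coeFn_add p.snd q.snd] with x h1 h2 h3
    simp only [WithLp.add_snd, WithLp.add_fst]
    rw [h3, Pi.add_apply, h1, h2, coeff_add_right]
  smul_mem' := by
    intro c p hp
    filter_upwards [hp, Lp.coeFn_smul c p.snd] with x h1 h3
    simp only [WithLp.smul_snd, WithLp.smul_fst]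
    rw [h3, Pi.smul_apply, h1, coeff_smul_right, smul_eq_mul]

lemma mem_coeffGraph {π : ProjectiveRep G H} {μ : Measure G} {h : H}
    {p : WithLp 2 (H × Lp ℂ 2 μ)} :
    p ∈ coeffGraph π μ h ↔ (p.snd : G → ℂ) =ᵐ[μ] coeff π h p.fst := Iff.rfl

/-- L² convergence gives a.e. convergence along a subsequence, while V_h f is pointwise continuous
in f. Closedness makes the graph complete, as the adjoint of its projection to `H` requires. -/
lemma isClosed_coeffGraph (π : ProjectiveRep G H) (μ : Measure G) (h : H) :
    IsClosed (coeffGraph π μ h : Set (WithLp 2 (H × Lp ℂ 2 μ))) := by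
  refine isClosed_of_closure_subset fun p hp => ?_
  obtain ⟨u, hu, hlim⟩ := mem_closure_iff_seq_limit.1 hp
  have hfst : Filter.Tendsto (fun n => (u n).fst) Filter.atTop (𝓝 p.fst) :=
    ((WithLp.prod_continuous_ofLp 2 H (Lp ℂ 2 μ)).fst.tendsto p).comp hlim
  have hsnd : Filter.Tendsto (fun n => (u n).snd) Filter.atTop (𝓝 p.snd) :=
    ((WithLp.prod_continuous_ofLp 2 H (Lp ℂ 2 μ)).snd.tendsto p).comp hlim
  obtain ⟨φ, hφ, hae⟩ := (tendstoInMeasure_of_tendsto_Lp hsnd).exists_seq_tendsto_ae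
  have hall : ∀ᵐ x ∂μ, ∀ n, ((u n).snd : G → ℂ) x = coeff π h (u n).fst x :=
    ae_all_iff.2 fun n => hu n
  change (p.snd : G → ℂ) =ᵐ[μ] coeff π h p.fst
  filter_upwards [hae, hall] with x h1 h2
  refine tendsto_nhds_unique h1 ?_
  simp only [h2]
  exact (tendsto_const_nhds.inner (hfst.comp hφ.tendsto_atTop))

variable {μ : Measure G}

/-- The graph element attached to `f` with square-integrable `V_h f`. -/
noncomputable def graphElt (π : ProjectiveRep G H) {h f : H} (hf : MemLp (coeff π h f) 2 μ) :
    coeffGraph π μ h :=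
  ⟨WithLp.toLp 2 (f, hf.toLp), hf.coeFn_toLp⟩

lemma memLp_of_graph {π : ProjectiveRep G H} {h : H} (p : coeffGraph π μ h) :
    MemLp (coeff π h p.1.fst) 2 μ :=
  (memLp_congr_ae (mem_coeffGraph.1 p.2)).1 (Lp.memLp p.1.snd)

lemma inner_graph {π : ProjectiveRep G H} {h : H} (p q : coeffGraph π μ h) :
    inner ℂ p q = inner ℂ p.1.fst q.1.fst
      + ∫ x, inner ℂ (coeff π h p.1.fst x) (coeff π h q.1.fst x) ∂μ := by
  rw [Submodule.coe_inner, WithLp.prod_inner_apply, L2.inner_def]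
  congr 1
  refine integral_congr_ae ?_
  filter_upwards [mem_coeffGraph.1 p.2, mem_coeffGraph.1 q.2] with x h1 h2
  exact congrArg₂ _ h1 h2

lemma fst_graphElt (π : ProjectiveRep G H) {h f : H} (hf : MemLp (coeff π h f) 2 μ) :
    (graphElt π hf).1.fst = f := rfl

/-- Applied with `K` the graph of V_h and `ι` its first coordinate. -/
lemma IsIrreducible.exists_apply_adjoint_eq_smul [CompleteSpace H] {π : ProjectiveRep G H}
    (hπ : IsIrreducible π) {K : Type*} [NormedAddCommGroup K] [InnerProductSpace ℂ K]
    [CompleteSpace K] (ι : K →L[ℂ] H)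
    (hι : ∀ y u, ι (ContinuousLinearMap.adjoint ι (π.op y u))
      = π.op y (ι (ContinuousLinearMap.adjoint ι u))) :
    ∃ c : ℝ, ∀ v, ι (ContinuousLinearMap.adjoint ι v) = (c : ℂ) • v := by
  refine hπ.exists_eq_smul (T := ι ∘L ContinuousLinearMap.adjoint ι) ?_ hι
  rw [ContinuousLinearMap.isSelfAdjoint_iff', ContinuousLinearMap.adjoint_comp,
    ContinuousLinearMap.adjoint_adjoint]

variable [IsTopologicalGroup G] [BorelSpace G] [μ.IsMulLeftInvariant]

lemma memLp_coeff_op (π : ProjectiveRep G H) {h f : H} (hf : MemLp (coeff π h f) 2 μ) (y : G) :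
    MemLp (coeff π h (π.op y f)) 2 μ := by
  have h1 : MemLp (fun x => coeff π h f (y⁻¹ * x)) 2 μ :=
    hf.comp_measurePreserving (measurePreserving_mul_left μ y⁻¹)
  exact h1.of_le (stronglyMeasurable_coeff π _ _).aestronglyMeasurable
    (Filter.Eventually.of_forall fun x => (norm_coeff_op_right π h f x y).le)

/-- Left invariance absorbs `y`, and the phases cancel because both entries carry the same one. -/
lemma integral_coeff_op (π : ProjectiveRep G H) (h f f' : H) (y : G) :
    ∫ x, inner ℂ (coeff π h (π.op y f) x) (coeff π h (π.op y f') x) ∂μ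
      = ∫ x, inner ℂ (coeff π h f x) (coeff π h f' x) ∂μ := by
  rw [← integral_mul_left_eq_self (μ := μ)
    (fun x => (inner ℂ (coeff π h f x) (coeff π h f' x) : ℂ)) y⁻¹]
  congr 1
  funext x
  rw [coeff_op_right, coeff_op_right]
  simp only [RCLike.inner_apply, map_mul]
  rw [mul_mul_mul_comm, Complex.mul_conj, Complex.normSq_eq_norm_sq, Circle.norm_coe]
  simp

lemma inner_graphElt_op (π : ProjectiveRep G H) {h f : H} (p q : coeffGraph π μ h) (y : G)
    (hf : MemLp (coeff π h f) 2 μ) (hq : q.1.fst = π.op y f) :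
    inner ℂ (graphElt π (memLp_coeff_op π (memLp_of_graph p) y)) q
      = inner ℂ p (graphElt π hf) := by
  rw [inner_graph, inner_graph, fst_graphElt, fst_graphElt, hq, integral_coeff_op,
    LinearIsometryEquiv.inner_map_map]

set_option maxHeartbeats 1000000 in
/-- If one coefficient with analyzing vector `h` is square-integrable, then `V_h` is a multiple of an
isometry. -/
theorem exists_norm_sq_coeff [CompleteSpace H] {π : ProjectiveRep G H} (hπ : IsIrreducible π)
    {h f₀ : H} (hf₀ : MemLp (coeff π h f₀) 2 μ) (hne : f₀ ≠ 0) :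
    ∃ c : ℝ, ∀ f, MemLp (coeff π h f) 2 μ ∧ ∫ x, ‖coeff π h f x‖ ^ 2 ∂μ = c * ‖f‖ ^ 2 := by
  have : CompleteSpace (coeffGraph π μ h) :=
    (isClosed_coeffGraph π μ h).completeSpace_coe
  obtain ⟨ι, hι⟩ : ∃ ι : coeffGraph π μ h →L[ℂ] H, ∀ p, ι p = p.1.fst :=
    ⟨(WithLp.fstL 2 ℂ H (Lp ℂ 2 μ)).comp (coeffGraph π μ h).subtypeL, fun p => rfl⟩
  -- Translation by `y` preserves the graph inner product and is intertwined by ι with π(y); hence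
  -- ι* intertwines them as well.
  have hadj : ∀ y u, ContinuousLinearMap.adjoint ι (π.op y u)
      = graphElt π (memLp_coeff_op π (memLp_of_graph (ContinuousLinearMap.adjoint ι u)) y) := by
    intro y u
    refine ext_inner_right ℂ fun q => ?_
    obtain ⟨f, hf⟩ : ∃ f, π.op y f = q.1.fst := (π.op y).surjective _
    -- π(y⁻¹) π(y) f equals f up to a phase, so both coefficients have the same modulus.
    have hfm : MemLp (coeff π h f) 2 μ := by
      have h1 := memLp_coeff_op π (memLp_of_graph q) y⁻¹
      rw [← hf] at h1
      refine h1.of_le (stronglyMeasurable_coeff π _ _).aestronglyMeasurable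
        (Filter.Eventually.of_forall fun x => ?_)
      rw [norm_coeff_op_right, norm_coeff_op_right, inv_inv, inv_mul_cancel_left]
    rw [ContinuousLinearMap.adjoint_inner_left, inner_graphElt_op π _ q y hfm hf.symm,
      ContinuousLinearMap.adjoint_inner_left, hι, hι, fst_graphElt, ← hf,
      LinearIsometryEquiv.inner_map_map]
  have hcomm : ∀ y u, ι (ContinuousLinearMap.adjoint ι (π.op y u))
      = π.op y (ι (ContinuousLinearMap.adjoint ι u)) := fun y u =>
    (congrArg ι (hadj y u)).trans ((hι _).trans ((fst_graphElt π _).trans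
      (congrArg (π.op y) (hι (ContinuousLinearMap.adjoint ι u)).symm)))
  obtain ⟨c, hc⟩ := IsIrreducible.exists_apply_adjoint_eq_smul hπ (K := coeffGraph π μ h) ι hcomm
  have hc' : ∀ v, (ContinuousLinearMap.adjoint ι v).1.fst = (c : ℂ) • v := fun v => by
    rw [← hι, hc]
  -- If c = 0, then ι* f₀ = 0, and pairing it with the graph element of f₀ yields ‖f₀‖² = 0.
  have hc0 : (c : ℂ) ≠ 0 := by
    intro h0
    have h1 : ContinuousLinearMap.adjoint ι f₀ = 0 := by
      rw [← inner_self_eq_zero (𝕜 := ℂ), ContinuousLinearMap.adjoint_inner_left, hι, hc', h0,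
        zero_smul, inner_zero_right]
    have h2 := ContinuousLinearMap.adjoint_inner_left ι (graphElt π hf₀) f₀
    rw [h1, inner_zero_left, hι, fst_graphElt] at h2
    exact hne (inner_self_eq_zero.1 h2.symm)
  -- ι* (c⁻¹ f) is a graph element over f, so V_h is defined everywhere.
  have hmem : ∀ f, MemLp (coeff π h f) 2 μ := by
    intro f
    have h1 := memLp_of_graph (ContinuousLinearMap.adjoint ι ((c : ℂ)⁻¹ • f))
    rwa [hc', smul_smul, mul_inv_cancel₀ hc0, one_smul] at h1
  -- Pairing ι* f with the graph element of f gives ‖f‖² = c ‖f‖² + c ∫ |V_h f|².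
  refine ⟨c⁻¹ - 1, fun f => ⟨hmem f, ?_⟩⟩
  have h1 := inner_graph (ContinuousLinearMap.adjoint ι f) (graphElt π (hmem f))
  rw [ContinuousLinearMap.adjoint_inner_left, hc', inner_smul_left] at h1
  have h2 : ∀ x, (inner ℂ (coeff π h ((c : ℂ) • f) x) (coeff π h f x) : ℂ)
      = c * ((‖coeff π h f x‖ ^ 2 : ℝ) : ℂ) := by
    intro x
    rw [coeff_smul_right, ← smul_eq_mul, inner_smul_left, inner_self_eq_norm_sq_to_K]
    simp
  rw [hι, fst_graphElt, integral_congr_ae (Filter.Eventually.of_forall h2)] at h1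
  have hself : (inner ℂ f f : ℂ) = ((‖f‖ ^ 2 : ℝ) : ℂ) := by
    rw [inner_self_eq_norm_sq_to_K]; simp
  rw [integral_const_mul, integral_complex_ofReal, hself] at h1
  have h3 : ‖f‖ ^ 2 = c * ‖f‖ ^ 2 + c * ∫ x, ‖coeff π h f x‖ ^ 2 ∂μ := by
    have := h1
    simp only [Complex.conj_ofReal] at this
    exact_mod_cast this
  have hc0' : c ≠ 0 := by exact_mod_cast hc0
  field_simp
  linarith

end Orthogonality

/-! ### Inversion invariance, orthogonality relations and the formal degree. -/

section FormalDegree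

/-- The Haar measure of a second countable unimodular group is invariant under inversion. -/
lemma isInvInvariant_of_unimodular {G : Type*} [Group G] [TopologicalSpace G]
    [IsTopologicalGroup G] [T2Space G] [LocallyCompactSpace G] [SecondCountableTopology G]
    [MeasurableSpace G] [BorelSpace G] (μ : Measure G) [μ.IsHaarMeasure]
    [μ.IsMulRightInvariant] : μ.IsInvInvariant := by
  constructor
  -- `μ.inv` is left-invariant because μ is right-invariant, hence a multiple of μ. Inverting twice
  -- gives c² = 1.
  obtain ⟨c, hc⟩ : ∃ c : ℝ≥0∞, μ.inv = c • μ :=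
    ⟨Measure.haarScalarFactor μ.inv μ, Measure.isMulLeftInvariant_eq_smul_of_regular μ.inv μ⟩
  have : Measure.map Inv.inv (Measure.map Inv.inv μ) = c ^ 2 • μ := by
    rw [← Measure.inv_def μ, hc, Measure.map_smul, ← Measure.inv_def μ, hc, smul_smul, pow_two]
  have μeq : μ = c ^ 2 • μ := by
    rw [Measure.map_map continuous_inv.measurable continuous_inv.measurable] at this
    simpa only [inv_involutive, Function.Involutive.comp_self, Measure.map_id]
  let K : TopologicalSpace.PositiveCompacts G := Classical.arbitrary _
  have : c ^ 2 * μ K = 1 ^ 2 * μ K := by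
    conv_rhs => rw [μeq]
    simp
  have : c ^ 2 = 1 ^ 2 :=
    (ENNReal.mul_left_inj (Measure.measure_pos_of_nonempty_interior _ K.interior_nonempty).ne'
          K.isCompact.measure_lt_top.ne).1 this
  have : c = 1 := (ENNReal.pow_right_strictMono two_ne_zero).injective this
  rw [hc, this, one_smul]

variable {G : Type*} [Group G] [TopologicalSpace G] [IsTopologicalGroup G]
  [MeasurableSpace G] [BorelSpace G] {μ : Measure G}
  {H : Type*} [NormedAddCommGroup H] [InnerProductSpace ℂ H] [CompleteSpace H]

/-- Norm form of the orthogonality relations, with the reciprocal formal degree `c`. -/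
theorem IsDiscreteSeries.exists_integral_norm_sq [TopologicalSpace.SeparableSpace H]
    [μ.IsMulLeftInvariant] [μ.IsInvInvariant] [NeZero μ]
    {π : ProjectiveRep G H} (hπ : IsDiscreteSeries π μ) :
    ∃ c : ℝ, 0 < c ∧ ∀ g f, MemLp (coeff π g f) 2 μ ∧
      ∫ x, ‖coeff π g f x‖ ^ 2 ∂μ = c * ‖f‖ ^ 2 * ‖g‖ ^ 2 := by
  obtain ⟨hirr, h, hne, hint⟩ := hπ
  have hn : 0 < ‖h‖ := norm_pos_iff.2 hne
  have hh : MemLp (coeff π h h) 2 μ :=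
    (memLp_two_iff_integrable_sq_norm (stronglyMeasurable_coeff π h h).aestronglyMeasurable).2 hint
  obtain ⟨c, hc⟩ := exists_norm_sq_coeff hirr hh hne
  -- Inversion turns |V_h f| into |V_f h|, so every vector has a square-integrable coefficient
  -- against `h`.
  have hswap : ∀ f, MemLp (coeff π f h) 2 μ ∧ ∫ x, ‖coeff π f h x‖ ^ 2 ∂μ = c * ‖f‖ ^ 2 := by
    intro f
    have h1 : MemLp (fun x => coeff π h f x⁻¹) 2 μ :=
      (hc f).1.comp_measurePreserving (Measure.measurePreserving_inv μ)
    refine ⟨h1.of_le (stronglyMeasurable_coeff π _ _).aestronglyMeasurable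
      (Filter.Eventually.of_forall fun x => (norm_coeff_swap π h f x).le), ?_⟩
    simp only [norm_coeff_swap π h f]
    rw [integral_inv_eq_self (fun x => ‖coeff π h f x‖ ^ 2) μ, (hc f).2]
  have hcnn : 0 ≤ c := by
    have h1 : 0 ≤ c * ‖h‖ ^ 2 := (hc h).2 ▸ integral_nonneg fun x => by positivity
    exact nonneg_of_mul_nonneg_left h1 (by positivity)
  -- If c = 0, the coefficients of a countable dense set all vanish at a common x, which forces π(x)
  -- h = 0.
  have hc0 : c ≠ 0 := by
    intro h0
    have hz : ∀ f, ∀ᵐ x ∂μ, coeff π h f x = 0 := by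
      intro f
      have h1 := (hc f).2
      rw [h0, zero_mul, integral_eq_zero_iff_of_nonneg (fun x => by positivity)
        ((memLp_two_iff_integrable_sq_norm
          (stronglyMeasurable_coeff π h f).aestronglyMeasurable).1 (hc f).1)] at h1
      filter_upwards [h1] with x hx
      simpa using hx
    obtain ⟨x, hx⟩ := (ae_all_iff.2 fun n => hz (TopologicalSpace.denseSeq H n)).exists
    have h2 : π.op x h = 0 := by
      have h3 : (fun v => inner ℂ (π.op x h) v) = fun _ => (0 : ℂ) :=
        (TopologicalSpace.denseRange_denseSeq H).equalizer
          (by fun_prop) continuous_const (funext hx)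
      exact inner_self_eq_zero.1 (congrFun h3 (π.op x h))
    exact hne ((π.op x).map_eq_zero_iff.1 h2)
  refine ⟨c / ‖h‖ ^ 2, by positivity, fun g f => ?_⟩
  obtain ⟨c', hc'⟩ := exists_norm_sq_coeff hirr (hswap g).1 hne
  refine ⟨(hc' f).1, ?_⟩
  -- Two evaluations of ∫ |V_g h|² determine the constant belonging to `g`.
  have h1 : c' * ‖h‖ ^ 2 = c * ‖g‖ ^ 2 := (hc' h).2 ▸ (hswap g).2
  rw [(hc' f).2]
  field_simp
  linear_combination ‖f‖ ^ 2 * h1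

omit [CompleteSpace H] in
/-- A sesquilinear map (antilinear in the first entry) vanishing on the diagonal is zero. -/
lemma eq_zero_of_sesquilinear {φ : H → H → ℂ} (hadd₁ : ∀ x x' y, φ (x + x') y = φ x y + φ x' y)
    (hadd₂ : ∀ x y y', φ x (y + y') = φ x y + φ x y')
    (hI₁ : ∀ x y, φ (Complex.I • x) y = -Complex.I * φ x y)
    (hI₂ : ∀ x y, φ x (Complex.I • y) = Complex.I * φ x y) (h0 : ∀ x, φ x x = 0) (x y : H) :
    φ x y = 0 := by
  have h1 := h0 (x + y)
  have h2 := h0 (x + Complex.I • y)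
  simp only [hadd₁, hadd₂, hI₁, hI₂, h0] at h1 h2
  have h3 : Complex.I * (φ x y - φ y x) = 0 := by linear_combination h2
  have h4 := (mul_eq_zero.1 h3).resolve_left Complex.I_ne_zero
  linear_combination (h1 + h4) / 2

omit [CompleteSpace H] [IsTopologicalGroup G] [BorelSpace G] in
-- Polarize twice: the defect `S` vanishes for f₁ = f₂, g₁ = g₂, and is sesquilinear in the f's and
-- in the g's.
lemma isFormalDegree_of_integral_norm_sq {π : ProjectiveRep G H} {c : ℝ} (hc : 0 < c)
    (h : ∀ g f, MemLp (coeff π g f) 2 μ ∧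
      ∫ x, ‖coeff π g f x‖ ^ 2 ∂μ = c * ‖f‖ ^ 2 * ‖g‖ ^ 2) :
    IsFormalDegree π μ c⁻¹ := by
  have hint : ∀ g₁ f₁ g₂ f₂, Integrable (fun x => coeff π g₁ f₁ x * star (coeff π g₂ f₂ x)) μ :=
    fun g₁ f₁ g₂ f₂ => (h g₁ f₁).1.integrable_mul (h g₂ f₂).1.star
  have hself : ∀ f : H, (inner ℂ f f : ℂ) = ((‖f‖ ^ 2 : ℝ) : ℂ) := fun f => by
    rw [inner_self_eq_norm_sq_to_K]; simp
  let S : H → H → H → H → ℂ := fun f₁ f₂ g₁ g₂ =>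
    ∫ x, coeff π g₁ f₁ x * star (coeff π g₂ f₂ x) ∂μ
      - (c : ℂ) * inner ℂ f₂ f₁ * star (inner ℂ g₂ g₁)
  have hdiag : ∀ f g, S f f g g = 0 := by
    intro f g
    have h1 : ∀ x, coeff π g f x * star (coeff π g f x) = ((‖coeff π g f x‖ ^ 2 : ℝ) : ℂ) := by
      intro x
      rw [Complex.star_def, Complex.mul_conj, Complex.normSq_eq_norm_sq]
    simp only [S, h1]
    rw [integral_complex_ofReal, (h g f).2, hself, hself, Complex.star_def, Complex.conj_ofReal]
    push_cast
    ring
  have hadd₁ : ∀ f f' f₂ g₁ g₂, S (f + f') f₂ g₁ g₂ = S f f₂ g₁ g₂ + S f' f₂ g₁ g₂ := by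
    intro f f' f₂ g₁ g₂
    simp only [S, coeff_add_right, add_mul, inner_add_right]
    rw [integral_add (hint _ _ _ _) (hint _ _ _ _)]
    ring
  have hadd₂ : ∀ f₁ f f' g₁ g₂, S f₁ (f + f') g₁ g₂ = S f₁ f g₁ g₂ + S f₁ f' g₁ g₂ := by
    intro f₁ f f' g₁ g₂
    simp only [S, coeff_add_right, star_add, mul_add, inner_add_left]
    rw [integral_add (hint _ _ _ _) (hint _ _ _ _)]
    ring
  have hadd₃ : ∀ f₁ f₂ g g' g₂, S f₁ f₂ (g + g') g₂ = S f₁ f₂ g g₂ + S f₁ f₂ g' g₂ := by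
    intro f₁ f₂ g g' g₂
    simp only [S, coeff_add_left, add_mul, inner_add_right, star_add]
    rw [integral_add (hint _ _ _ _) (hint _ _ _ _)]
    ring
  have hadd₄ : ∀ f₁ f₂ g₁ g g', S f₁ f₂ g₁ (g + g') = S f₁ f₂ g₁ g + S f₁ f₂ g₁ g' := by
    intro f₁ f₂ g₁ g g'
    simp only [S, coeff_add_left, star_add, mul_add, inner_add_left]
    rw [integral_add (hint _ _ _ _) (hint _ _ _ _)]
    ring
  have hI₁ : ∀ f₁ f₂ g₁ g₂, S (Complex.I • f₁) f₂ g₁ g₂ = Complex.I * S f₁ f₂ g₁ g₂ := by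
    intro f₁ f₂ g₁ g₂
    simp only [S, coeff_smul_right, inner_smul_right, mul_assoc]
    rw [integral_const_mul]
    ring
  have hI₂ : ∀ f₁ f₂ g₁ g₂, S f₁ (Complex.I • f₂) g₁ g₂ = -Complex.I * S f₁ f₂ g₁ g₂ := by
    intro f₁ f₂ g₁ g₂
    simp only [S, coeff_smul_right, inner_smul_left, Complex.star_def, map_mul, Complex.conj_I,
      mul_left_comm _ (-Complex.I)]
    rw [integral_const_mul]
    ring
  have hI₃ : ∀ f₁ f₂ g₁ g₂, S f₁ f₂ (Complex.I • g₁) g₂ = -Complex.I * S f₁ f₂ g₁ g₂ := by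
    intro f₁ f₂ g₁ g₂
    simp only [S, coeff_smul_left, inner_smul_right, Complex.star_def, map_mul, Complex.conj_I,
      mul_assoc]
    rw [integral_const_mul]
    ring
  have hI₄ : ∀ f₁ f₂ g₁ g₂, S f₁ f₂ g₁ (Complex.I • g₂) = Complex.I * S f₁ f₂ g₁ g₂ := by
    intro f₁ f₂ g₁ g₂
    simp only [S, coeff_smul_left, inner_smul_left, Complex.star_def, map_mul, Complex.conj_I,
      map_neg, neg_neg, mul_left_comm _ Complex.I]
    rw [integral_const_mul]
    ring
  have hg : ∀ f₁ f₂ g, S f₁ f₂ g g = 0 := fun f₁ f₂ g =>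
    eq_zero_of_sesquilinear (φ := fun f₂ f₁ => S f₁ f₂ g g) (fun _ _ _ => hadd₂ _ _ _ _ _)
      (fun _ _ _ => hadd₁ _ _ _ _ _) (fun _ _ => hI₂ _ _ _ _) (fun _ _ => hI₁ _ _ _ _)
      (fun f => hdiag f g) f₂ f₁
  refine ⟨inv_pos.2 hc, fun f₁ f₂ g₁ g₂ => ?_⟩
  have h5 : S f₁ f₂ g₁ g₂ = 0 :=
    eq_zero_of_sesquilinear (φ := fun g₁ g₂ => S f₁ f₂ g₁ g₂) (fun _ _ _ => hadd₃ _ _ _ _ _)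
      (fun _ _ _ => hadd₄ _ _ _ _ _) (fun _ _ => hI₃ _ _ _ _) (fun _ _ => hI₄ _ _ _ _)
      (fun g => hg f₁ f₂ g) g₁ g₂
  rw [Complex.ofReal_inv, inv_inv]
  exact sub_eq_zero.1 h5

omit [CompleteSpace H] [IsTopologicalGroup G] [BorelSpace G] in
lemma IsFormalDegree.eq [Nontrivial H] {π : ProjectiveRep G H} {a b : ℝ}
    (ha : IsFormalDegree π μ a) (hb : IsFormalDegree π μ b) : a = b := by
  obtain ⟨f, hf⟩ := exists_ne (0 : H)
  have h1 := (ha.2 f f f f).symm.trans (hb.2 f f f f)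
  have h2 : (inner ℂ f f : ℂ) ≠ 0 := inner_self_ne_zero.2 hf
  have h3 := mul_right_cancel₀ h2 (mul_right_cancel₀ (star_ne_zero.2 h2) h1)
  exact_mod_cast inv_injective h3

omit [CompleteSpace H] [IsTopologicalGroup G] [BorelSpace G] in
lemma IsFormalDegree.formalDegree_eq [Nontrivial H] {π : ProjectiveRep G H} {a : ℝ}
    (ha : IsFormalDegree π μ a) : formalDegree π μ = a := by
  have h : ∃ a, IsFormalDegree π μ a := ⟨a, ha⟩
  rw [formalDegree, dif_pos h]
  exact h.choose_spec.eq ha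

/-- The coefficient identity `∫ |V_g f|² = dπ⁻¹ ‖f‖² ‖g‖²`, in terms of the formal degree. -/
theorem IsDiscreteSeries.lintegral_coeff [TopologicalSpace.SeparableSpace H]
    [μ.IsMulLeftInvariant] [μ.IsInvInvariant] [NeZero μ]
    {π : ProjectiveRep G H} (hπ : IsDiscreteSeries π μ) :
    0 < formalDegree π μ ∧ ∀ g f, ∫⁻ x, ENNReal.ofReal (‖coeff π g f x‖ ^ 2) ∂μ
      = ENNReal.ofReal ((formalDegree π μ)⁻¹ * ‖f‖ ^ 2 * ‖g‖ ^ 2) := by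
  obtain ⟨c, hc, h⟩ := hπ.exists_integral_norm_sq
  obtain ⟨-, v, hv, -⟩ := hπ
  have : Nontrivial H := ⟨v, 0, hv⟩
  have hd := isFormalDegree_of_integral_norm_sq hc h
  rw [hd.formalDegree_eq]
  refine ⟨inv_pos.2 hc, fun g f => ?_⟩
  rw [inv_inv, ← (h g f).2, ofReal_integral_eq_lintegral_ofReal
    ((memLp_two_iff_integrable_sq_norm
      (stronglyMeasurable_coeff π g f).aestronglyMeasurable).1 (h g f).1)
    (Filter.Eventually.of_forall fun x => by positivity)]

end FormalDegree

/-! ### Dimension counts for frames and Riesz sequences -/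

section Dimension

variable {G : Type*} [Group G] [TopologicalSpace G] [MeasurableSpace G]
  {H : Type*} [NormedAddCommGroup H] [InnerProductSpace ℂ H]

lemma norm_sq_starProjection_eq_sum (W : Submodule ℂ H) [FiniteDimensional ℂ W] (v : H) :
    ‖W.starProjection v‖ ^ 2
      = ∑ i, ‖inner ℂ v ((stdOrthonormalBasis ℂ W i : W) : H)‖ ^ 2 := by
  have h1 : ‖W.starProjection v‖ = ‖W.orthogonalProjectionOnto v‖ := rfl
  rw [h1, ← (stdOrthonormalBasis ℂ W).sum_sq_norm_inner_right (W.orthogonalProjectionOnto v)]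
  refine Finset.sum_congr rfl fun i _ => ?_
  rw [norm_inner_symm v, ← Submodule.inner_orthogonalProjectionOnto_eq_of_mem_left]

/-- By Pythagoras the left side is the squared distance from `v` to `W`. -/
lemma norm_sq_sub_norm_sq_starProjection_le (W : Submodule ℂ H) [FiniteDimensional ℂ W] (v w : H)
    (hw : w ∈ W) : ‖v‖ ^ 2 - ‖W.starProjection v‖ ^ 2 ≤ ‖v - w‖ ^ 2 := by
  have h1 := W.norm_sq_eq_add_norm_sq_starProjection v
  have h2 : ‖v - w‖ ^ 2 = ‖Wᗮ.starProjection v‖ ^ 2 + ‖W.starProjection (v - w)‖ ^ 2 := by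
    have h3 := W.norm_sq_eq_add_norm_sq_starProjection (v - w)
    have h4 : Wᗮ.starProjection w = 0 := by
      rw [Submodule.starProjection_orthogonal_val, Submodule.starProjection_eq_self_iff.2 hw,
        sub_self]
    rw [h3, map_sub (Wᗮ.starProjection), h4, sub_zero, add_comm]
  nlinarith [sq_nonneg ‖W.starProjection (v - w)‖]

/-- Expand in an orthonormal basis of `W`; each basis vector contributes dπ⁻¹ ‖g‖². This is the link
between dimension and volume. -/
lemma IsDiscreteSeries.lintegral_norm_sq_starProjection [CompleteSpace H]
    [TopologicalSpace.SeparableSpace H] [IsTopologicalGroup G] [BorelSpace G] {μ : Measure G}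
    [μ.IsMulLeftInvariant] [μ.IsInvInvariant] [NeZero μ]
    {π : ProjectiveRep G H} (hπ : IsDiscreteSeries π μ) (g : H)
    (W : Submodule ℂ H) [FiniteDimensional ℂ W] :
    ∫⁻ x, ENNReal.ofReal (‖W.starProjection (π.op x g)‖ ^ 2) ∂μ
      = ENNReal.ofReal ((formalDegree π μ)⁻¹ * ‖g‖ ^ 2 * Module.finrank ℂ W) := by
  obtain ⟨hpos, hd⟩ := hπ.lintegral_coeff
  have h1 : ∀ x, ENNReal.ofReal (‖W.starProjection (π.op x g)‖ ^ 2)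
      = ∑ i, ENNReal.ofReal (‖coeff π g ((stdOrthonormalBasis ℂ W i : W) : H) x‖ ^ 2) := by
    intro x
    rw [norm_sq_starProjection_eq_sum, ENNReal.ofReal_sum_of_nonneg fun i _ => by positivity]
    rfl
  simp only [h1]
  rw [lintegral_finsetSum _ fun i _ =>
    ((stronglyMeasurable_coeff π g _).norm.measurable.pow_const 2).ennreal_ofReal]
  have h2 : ∀ i, ‖((stdOrthonormalBasis ℂ W i : W) : H)‖ = 1 := fun i =>
    (stdOrthonormalBasis ℂ W).orthonormal.1 i
  simp only [hd, h2]
  rw [← ENNReal.ofReal_sum_of_nonneg fun i _ => by positivity]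
  congr 1
  rw [Finset.sum_const, Finset.card_univ, Fintype.card_fin, nsmul_eq_mul]
  ring

lemma norm_sq_lp_eq_tsum {ι : Type*} (c : lp (fun _ : ι => ℂ) 2) :
    HasSum (fun i => ‖c i‖ ^ 2) (‖c‖ ^ 2) := by
  have h := lp.hasSum_norm (p := 2) (by norm_num) c
  simpa using h

lemma norm_sq_compl_sum_single {ι : Type*} [DecidableEq ι] (c : lp (fun _ : ι => ℂ) 2)
    (s : Finset ι) :
    ‖c - ∑ i ∈ s, lp.single 2 i (c i)‖ ^ 2 = ‖c‖ ^ 2 - ∑ i ∈ s, ‖c i‖ ^ 2 := by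
  have h := lp.norm_compl_sum_single (p := 2) (by norm_num) c s
  simpa using h

/-- The analysis operator of a frame. -/
lemma IsFrame.exists_analysis {π : ProjectiveRep G H} {g : H} {Λ : Set G} {A B : ℝ}
    (hF : IsFrame π g Λ A B) :
    ∃ C : H →L[ℂ] lp (fun _ : Λ => ℂ) 2, ∀ f (l : Λ), C f l = coeff π g f l := by
  have hmem : ∀ f, Memℓp (fun l : Λ => coeff π g f l) 2 := fun f =>
    memℓp_gen (by simpa using (hF f).1)
  let C₀ : H →ₗ[ℂ] lp (fun _ : Λ => ℂ) 2 :=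
    { toFun := fun f => ⟨fun l => coeff π g f l, hmem f⟩
      map_add' := fun f f' => by
        ext l
        exact coeff_add_right π g f f' l
      map_smul' := fun a f => by
        ext l
        exact coeff_smul_right π g f a l }
  refine ⟨C₀.mkContinuous (Real.sqrt |B|) fun f => ?_, fun f l => rfl⟩
  refine abs_le_of_sq_le_sq' ?_ (by positivity) |>.2
  rw [← (norm_sq_lp_eq_tsum (C₀ f)).tsum_eq, mul_pow, Real.sq_sqrt (abs_nonneg B)]
  exact (hF f).2.2.trans (mul_le_mul_of_nonneg_right (le_abs_self B) (by positivity))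

/-- For a frame and a finite set `s` of indices there is a subspace `W` of dimension at most `#s`
such that the distance of `v` to `W` is controlled by the frame coefficients of `v` off `s`. -/
theorem IsFrame.exists_subspace [CompleteSpace H] {π : ProjectiveRep G H} {g : H} {Λ : Set G}
    {A B : ℝ} (hA : 0 < A) (hF : IsFrame π g Λ A B) (s : Finset Λ) :
    ∃ W : Submodule ℂ H, ∃ _ : FiniteDimensional ℂ W, Module.finrank ℂ W ≤ s.card ∧
      ∀ v M, (∀ u : Finset Λ, Disjoint u s → ∑ l ∈ u, ‖coeff π g v l‖ ^ 2 ≤ M) →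
        A * (‖v‖ ^ 2 - ‖W.starProjection v‖ ^ 2) ≤ M := by
  classical
  obtain ⟨C, hC⟩ := hF.exists_analysis
  have hlow : ∀ f, A * ‖f‖ ^ 2 ≤ ‖C f‖ ^ 2 := by
    intro f
    rw [← (norm_sq_lp_eq_tsum (C f)).tsum_eq]
    simpa only [hC] using (hF f).2.1
  have hanti : AntilipschitzWith (Real.toNNReal (Real.sqrt A)⁻¹) C := by
    refine AddMonoidHomClass.antilipschitz_of_bound C fun f => ?_
    rw [Real.coe_toNNReal _ (by positivity), inv_mul_eq_div, le_div_iff₀ (by positivity)]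
    refine abs_le_of_sq_le_sq' ?_ (by positivity) |>.2
    rw [mul_pow, Real.sq_sqrt hA.le, mul_comm]
    exact hlow f
  let R : Submodule ℂ (lp (fun _ : Λ => ℂ) 2) := LinearMap.range C.toLinearMap
  have hRc : IsClosed (R : Set (lp (fun _ : Λ => ℂ) 2)) := by
    rw [LinearMap.coe_range]
    exact hanti.isClosed_range C.uniformContinuous
  have : CompleteSpace R := hRc.completeSpace_coe
  let e : H ≃ₗ[ℂ] R := LinearEquiv.ofInjective C.toLinearMap hanti.injective
  -- The left inverse of `C` that kills the complement of its range; it sends unit vectors to the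
  -- canonical dual frame.
  let L : lp (fun _ : Λ => ℂ) 2 →ₗ[ℂ] H := e.symm.toLinearMap ∘ₗ R.orthogonalProjectionOnto.toLinearMap
  have hCL : ∀ c, C (L c) = R.orthogonalProjectionOnto c := fun c =>
    congrArg Subtype.val (e.apply_symm_apply (R.orthogonalProjectionOnto c))
  have hLC : ∀ f, L (C f) = f := fun f => hanti.injective (by
    rw [hCL]
    exact Submodule.starProjection_eq_self_iff.2 ⟨f, rfl⟩)
  let W : Submodule ℂ H :=
    Submodule.span ℂ (s.image fun l => L (lp.single 2 l (1 : ℂ)) : Finset H)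
  have hfd : FiniteDimensional ℂ W := FiniteDimensional.span_finset ℂ _
  refine ⟨W, hfd, (finrank_span_finset_le_card _).trans Finset.card_image_le, fun v M hM => ?_⟩
  -- `w` is the part of the reconstruction of `v` indexed by `s`. `C (v - w)` is a projection of the
  -- omitted coefficients, hence no larger than they are.
  let w : H := L (∑ l ∈ s, lp.single 2 l (C v l))
  have hw : w ∈ W := by
    simp only [w, map_sum]
    refine Submodule.sum_mem _ fun l hl => ?_
    have h1 : (lp.single 2 l (C v l) : lp (fun _ : Λ => ℂ) 2)
        = C v l • lp.single 2 l (1 : ℂ) := by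
      rw [← lp.single_smul, smul_eq_mul, mul_one]
    rw [h1, map_smul]
    exact Submodule.smul_mem _ _ (Submodule.subset_span (Finset.mem_image_of_mem _ hl))
  have h1 : v - w = L (C v - ∑ l ∈ s, lp.single 2 l (C v l)) := by
    rw [map_sub, hLC]
  calc A * (‖v‖ ^ 2 - ‖W.starProjection v‖ ^ 2) ≤ A * ‖v - w‖ ^ 2 :=
        mul_le_mul_of_nonneg_left (norm_sq_sub_norm_sq_starProjection_le W v w hw) hA.le
    _ ≤ ‖C (v - w)‖ ^ 2 := hlow _
    _ ≤ ‖C v - ∑ l ∈ s, lp.single 2 l (C v l)‖ ^ 2 := by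
        rw [h1, hCL]
        gcongr
        exact R.norm_orthogonalProjectionOnto_apply_le _
    _ = ‖C v‖ ^ 2 - ∑ l ∈ s, ‖C v l‖ ^ 2 := norm_sq_compl_sum_single _ _
    _ ≤ M := by
        rw [sub_le_iff_le_add]
        refine hasSum_le_of_sum_le (norm_sq_lp_eq_tsum (C v)) fun t => ?_
        have h2 := hM (t \ s) Finset.sdiff_disjoint
        simp only [hC]
        calc ∑ l ∈ t, ‖coeff π g v l‖ ^ 2 ≤ ∑ l ∈ (t \ s) ∪ s, ‖coeff π g v l‖ ^ 2 :=
              Finset.sum_le_sum_of_subset_of_nonneg (by simp)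
                fun _ _ _ => by positivity
          _ = ∑ l ∈ t \ s, ‖coeff π g v l‖ ^ 2 + ∑ l ∈ s, ‖coeff π g v l‖ ^ 2 :=
              Finset.sum_union Finset.sdiff_disjoint
          _ ≤ _ := by gcongr

lemma IsRieszSequence.finset_bound {π : ProjectiveRep G H} {g : H} {Λ : Set G} {A B : ℝ}
    (hR : IsRieszSequence π g Λ A B) (s : Finset Λ) (a : Λ → ℂ) :
    A * ∑ l ∈ s, ‖a l‖ ^ 2 ≤ ‖∑ l ∈ s, a l • π.op (l : G) g‖ ^ 2 := by
  classical
  let c : lp (fun _ : Λ => ℂ) 2 := ∑ l ∈ s, lp.single 2 l (a l)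
  have hc : ∀ l, c l = if l ∈ s then a l else 0 := by
    intro l
    simp only [c]
    rw [lp.coeFn_sum, Finset.sum_apply]
    simp [Pi.single_apply]
  have hn : ‖c‖ ^ 2 = ∑ l ∈ s, ‖a l‖ ^ 2 := by
    have h := lp.norm_sum_single (p := 2) (by norm_num) a s
    simpa using h
  have hs : ∑' l : Λ, c l • π.op (l : G) g = ∑ l ∈ s, a l • π.op (l : G) g := by
    rw [tsum_eq_sum (s := s) fun l hl => by rw [hc, if_neg hl, zero_smul]]
    exact Finset.sum_congr rfl fun l hl => by rw [hc, if_pos hl]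
  rw [← hn, ← hs]
  exact (hR c).2.1

/-- For a Riesz sequence, the span `W` of the vectors with index in a finite set `s` has dimension
`#s`, and projections onto `W` are controlled by the coefficients with index in `s`. -/
theorem IsRieszSequence.exists_subspace {π : ProjectiveRep G H} {g : H}
    {Λ : Set G} {A B : ℝ} (hA : 0 < A) (hR : IsRieszSequence π g Λ A B) (s : Finset Λ) :
    ∃ W : Submodule ℂ H, ∃ _ : FiniteDimensional ℂ W, Module.finrank ℂ W = s.card ∧
      ∀ v, A * ‖W.starProjection v‖ ^ 2 ≤ ∑ l ∈ s, ‖coeff π g v l‖ ^ 2 := by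
  classical
  let W : Submodule ℂ H := Submodule.span ℂ (Set.range fun l : s => π.op ((l : Λ) : G) g)
  have hfd : FiniteDimensional ℂ W := FiniteDimensional.span_of_finite ℂ (Set.finite_range _)
  have hext : ∀ b : s → ℂ, ∃ a : Λ → ℂ, ∀ l : s, a l = b l := fun b =>
    ⟨fun l => if h : l ∈ s then b ⟨l, h⟩ else 0, fun l => by simp⟩
  have hli : LinearIndependent ℂ fun l : s => π.op ((l : Λ) : G) g := by
    rw [Fintype.linearIndependent_iff]
    intro b hb i
    obtain ⟨a, ha⟩ := hext b
    have h1 := hR.finset_bound s a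
    rw [← Finset.sum_coe_sort s fun l => a l • π.op (l : G) g] at h1
    simp only [ha] at h1
    rw [hb, norm_zero, zero_pow two_ne_zero] at h1
    have h2 : ‖a i‖ ^ 2 ≤ ∑ l ∈ s, ‖a l‖ ^ 2 :=
      Finset.single_le_sum (f := fun l => ‖a l‖ ^ 2) (fun _ _ => by positivity) i.2
    have h3 : ∑ l ∈ s, ‖a l‖ ^ 2 ≤ 0 := nonpos_of_mul_nonpos_right h1 hA
    rw [← ha, ← norm_eq_zero]
    exact pow_eq_zero_iff two_ne_zero |>.1 (le_antisymm (h2.trans h3) (by positivity))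
  refine ⟨W, hfd, ?_, fun v => ?_⟩
  · rw [finrank_span_eq_card hli, Fintype.card_coe]
  obtain ⟨b, hb⟩ := (Submodule.mem_span_range_iff_exists_fun ℂ).1
    (Submodule.starProjection_apply_mem W v)
  obtain ⟨a, ha⟩ := hext b
  have hPv : ∑ l ∈ s, a l • π.op (l : G) g = W.starProjection v := by
    rw [← hb, ← Finset.sum_coe_sort s]
    exact Finset.sum_congr rfl fun l _ => by rw [ha]
  have h1 := hR.finset_bound s a
  rw [hPv] at h1
  set S := ∑ l ∈ s, ‖coeff π g v l‖ ^ 2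
  set N := ∑ l ∈ s, ‖a l‖ ^ 2
  set p := ‖W.starProjection v‖
  have hS : 0 ≤ S := Finset.sum_nonneg fun _ _ => by positivity
  -- Expand ‖Pv‖² = ⟨Pv, v⟩ with Pv = ∑ a_l π(l) g. After Cauchy–Schwarz, the Riesz bound A ∑ |a_l|²
  -- ≤ ‖Pv‖² allows one factor ‖Pv‖² to be cancelled.
  have h2 : p ^ 2 ≤ ∑ l ∈ s, ‖a l‖ * ‖coeff π g v l‖ := by
    have h3 : (inner ℂ (W.starProjection v) v : ℂ) = ((p ^ 2 : ℝ) : ℂ) := by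
      have h4 : (inner ℂ (W.starProjection v) v : ℂ)
          = inner ℂ (W.starProjection v) (W.starProjection v) := by
        rw [← sub_eq_zero, ← inner_sub_right]
        exact Submodule.inner_right_of_mem_orthogonal (Submodule.starProjection_apply_mem W v)
          (Submodule.sub_starProjection_mem_orthogonal v)
      rw [h4, inner_self_eq_norm_sq_to_K]
      simp [p]
    have h5 : p ^ 2 = ‖(inner ℂ (W.starProjection v) v : ℂ)‖ := by
      rw [h3, Complex.norm_real, Real.norm_of_nonneg (by positivity)]
    rw [h5, ← hPv, sum_inner]
    refine (norm_sum_le _ _).trans (Finset.sum_le_sum fun l _ => ?_)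
    rw [inner_smul_left, norm_mul, RCLike.norm_conj, coeff]
  have h3 : (p ^ 2) ^ 2 ≤ N * S :=
    (pow_le_pow_left₀ (by positivity) h2 2).trans
      (Finset.sum_mul_sq_le_sq_mul_sq s (fun l => ‖a l‖) fun l => ‖coeff π g v l‖)
  rcases (sq_nonneg p).eq_or_lt with h0 | h0
  · rw [← h0, mul_zero]; exact hS
  · refine le_of_mul_le_mul_right ?_ h0
    nlinarith [mul_le_mul_of_nonneg_right h1 hS]

end Dimension

/-! ### Geometry of periodic metrics -/

section Geometry

variable {G : Type*} [Group G] [TopologicalSpace G] [MeasurableSpace G] {d : G → G → ℝ}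

namespace IsPeriodicMetric

lemma dist_eq (hd : IsPeriodicMetric d) (x y : G) : d x y = d (y⁻¹ * x) 1 := by
  rw [← hd.left_invariant x y y⁻¹, inv_mul_cancel]

lemma norm_inv (hd : IsPeriodicMetric d) (x : G) : d x⁻¹ 1 = d x 1 := by
  rw [← hd.left_invariant x⁻¹ 1 x, mul_inv_cancel, mul_one, hd.symm]

lemma norm_mul_le (hd : IsPeriodicMetric d) (x y : G) : d (x * y) 1 ≤ d x 1 + d y 1 := by
  have h1 := hd.triangle (x * y) x 1
  have h2 : d (x * y) x = d y 1 := by simpa using hd.left_invariant y 1 x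
  linarith

lemma norm_one (hd : IsPeriodicMetric d) : d 1 1 = 0 := (hd.eq_zero_iff 1 1).2 rfl

lemma norm_nonneg (hd : IsPeriodicMetric d) (x : G) : 0 ≤ d x 1 := hd.nonneg x 1

lemma measurable_norm (hd : IsPeriodicMetric d) : Measurable fun x => d x 1 :=
  hd.measurable.comp (measurable_id.prodMk measurable_const)

lemma measurableSet_oball (hd : IsPeriodicMetric d) (r : ℝ) : MeasurableSet (oball d r) :=
  hd.measurable_norm measurableSet_Iio

lemma exists_subset_oball (hd : IsPeriodicMetric d) {K : Set G} (hK : IsCompact K) :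
    ∃ ρ : ℝ, 0 < ρ ∧ K ⊆ oball d ρ := by
  obtain ⟨M, hM⟩ := hd.locally_bounded (K ×ˢ {1}) (hK.prod isCompact_singleton)
  refine ⟨max M 0 + 1, by positivity, fun x hx => ?_⟩
  have h1 : d x 1 ≤ M := hM ⟨(x, 1), ⟨hx, rfl⟩, rfl⟩
  exact lt_of_le_of_lt (h1.trans (le_max_left M 0)) (lt_add_one _)

lemma exists_oball_mem_nhds [LocallyCompactSpace G] (hd : IsPeriodicMetric d) :
    ∃ ρ : ℝ, 0 < ρ ∧ oball d ρ ∈ 𝓝 (1 : G) := by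
  obtain ⟨K, hK, h1⟩ := exists_compact_mem_nhds (1 : G)
  obtain ⟨ρ, hρ, hsub⟩ := hd.exists_subset_oball hK
  exact ⟨ρ, hρ, Filter.mem_of_superset h1 hsub⟩

lemma measure_oball_lt_top (hd : IsPeriodicMetric d) (μ : Measure G)
    [IsFiniteMeasureOnCompacts μ] (r : ℝ) : μ (oball d r) < ⊤ := by
  refine lt_of_le_of_lt (measure_mono fun x hx => subset_closure ?_)
    (hd.proper r).measure_lt_top
  rw [Set.mem_ofPred_eq, hd.symm]
  exact le_of_lt hx

/-- Since `d` need not induce the topology, closures are controlled through a ball that is a unit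
neighborhood. -/
lemma closure_oball_subset [IsTopologicalGroup G] (hd : IsPeriodicMetric d) {ρ : ℝ}
    (hρ : oball d ρ ∈ 𝓝 (1 : G)) (r : ℝ) : closure (oball d r) ⊆ oball d (r + ρ) := by
  intro x hx
  have h1 : (fun y => x⁻¹ * y) ⁻¹' oball d ρ ∈ 𝓝 x :=
    (continuous_const_mul x⁻¹).continuousAt.preimage_mem_nhds (by simpa using hρ)
  obtain ⟨y, hy1, hy2⟩ := mem_closure_iff_nhds.1 hx _ h1
  have h2 := hd.norm_mul_le y (x⁻¹ * y)⁻¹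
  rw [hd.norm_inv, mul_inv_rev, inv_inv, mul_inv_cancel_left] at h2
  have h3 : d y 1 < r := hy2
  have h4 : d (x⁻¹ * y) 1 < ρ := hy1
  change d x 1 < r + ρ
  linarith

/-- Chains with small steps give bounded word length. -/
lemma mem_pow_of_chain (hd : IsPeriodicMetric d) {s : ℝ} {V : Set G}
    (hV : ∀ y, d 1 y ≤ 2 * s → y ∈ V) {n : ℕ} {p : ℕ → G} (h0 : p 0 = 1)
    (hs : 0 ≤ s) (hstep : ∀ i < n, d (p i) (p (i + 1)) ≤ s) :
    ∃ m : ℕ, m * s ≤ ∑ i ∈ Finset.range n, d (p i) (p (i + 1)) ∧ p n ∈ V ^ (m + 1) := by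
  -- Greedy grouping: `q` is the end of the current word and `t` the length travelled since. A
  -- letter is spent only when `t` would exceed `s`, so it accounts for length above `s` and covers
  -- a displacement of at most `2 * s`.
  have key : ∀ i ≤ n, ∃ (m : ℕ) (q : G) (t : ℝ), q ∈ V ^ m ∧ d q (p i) ≤ t ∧ t ≤ s ∧
      t + m * s ≤ ∑ j ∈ Finset.range i, d (p j) (p (j + 1)) := by
    intro i
    induction i with
    | zero =>
      intro _
      exact ⟨0, 1, 0, by simp, by rw [h0, hd.norm_one], hs, by simp⟩
    | succ i ih =>
      intro hi
      obtain ⟨m, q, t, hq, hqt, hts, hsum⟩ := ih (by omega)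
      have h1 := hstep i (by omega)
      have h2 := hd.triangle q (p i) (p (i + 1))
      rw [Finset.sum_range_succ]
      by_cases h3 : t + d (p i) (p (i + 1)) ≤ s
      · exact ⟨m, q, _, hq, by linarith, h3, by linarith⟩
      · refine ⟨m + 1, p (i + 1), 0, ?_, by rw [(hd.eq_zero_iff _ _).2 rfl], hs, ?_⟩
        · rw [pow_succ]
          refine ⟨q, hq, q⁻¹ * p (i + 1), hV _ ?_, by simp⟩
          have h4 : d 1 (q⁻¹ * p (i + 1)) = d q (p (i + 1)) := by
            simpa using hd.left_invariant q (p (i + 1)) q⁻¹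
          linarith
        · push_cast
          linarith
  obtain ⟨m, q, t, hq, hqt, hts, hsum⟩ := key n le_rfl
  have ht : 0 ≤ t := (hd.nonneg _ _).trans hqt
  refine ⟨m, by linarith, ?_⟩
  rw [pow_succ]
  refine ⟨q, hq, q⁻¹ * p n, hV _ ?_, by simp⟩
  have h4 : d 1 (q⁻¹ * p n) = d q (p n) := by simpa using hd.left_invariant q (p n) q⁻¹
  linarith

end IsPeriodicMetric

omit [MeasurableSpace G] in
-- The powers of `U` are nested and exhaust `G`, and a point of `U ^ k` has a neighborhood inside `U
-- ^ (k + 1)`.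
lemma exists_subset_pow_of_isCompact [IsTopologicalGroup G] {U : Set G} (hU : U ∈ 𝓝 (1 : G))
    (hinv : U⁻¹ = U) (hgen : Subgroup.closure U = ⊤) {K : Set G} (hK : IsCompact K) :
    ∃ k : ℕ, K ⊆ U ^ k := by
  have h1U : (1 : G) ∈ U := mem_of_mem_nhds hU
  have hmem : ∀ x : G, ∃ k : ℕ, x ∈ U ^ k := by
    intro x
    have hx : x ∈ Subgroup.closure U := by rw [hgen]; trivial
    induction hx using Subgroup.closure_induction with
    | mem x hx => exact ⟨1, by simpa using hx⟩
    | one => exact ⟨0, by simp⟩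
    | mul x y _ _ hx hy =>
      obtain ⟨m, hm⟩ := hx
      obtain ⟨n, hn⟩ := hy
      exact ⟨m + n, by rw [pow_add]; exact Set.mul_mem_mul hm hn⟩
    | inv x _ hx =>
      obtain ⟨m, hm⟩ := hx
      refine ⟨m, ?_⟩
      rw [← hinv, inv_pow]
      exact Set.inv_mem_inv.2 hm
  refine hK.induction_on (p := fun s => ∃ k : ℕ, s ⊆ U ^ k) ⟨0, Set.empty_subset _⟩
    (fun s t hst ⟨k, hk⟩ => ⟨k, hst.trans hk⟩) ?_ ?_
  · rintro s t ⟨k, hk⟩ ⟨l, hl⟩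
    exact ⟨max k l, Set.union_subset
      (hk.trans (Set.pow_subset_pow_right h1U (le_max_left k l)))
      (hl.trans (Set.pow_subset_pow_right h1U (le_max_right k l)))⟩
  · intro x _
    obtain ⟨k, hk⟩ := hmem x
    refine ⟨U ^ (k + 1), mem_nhdsWithin_of_mem_nhds ?_, k + 1, subset_rfl⟩
    have h2 : (fun y => x⁻¹ * y) ⁻¹' U ∈ 𝓝 x :=
      (continuous_const_mul x⁻¹).continuousAt.preimage_mem_nhds (by simpa using hU)
    refine Filter.mem_of_superset h2 fun y hy => ?_
    rw [pow_succ]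
    exact ⟨x, hk, x⁻¹ * y, hy, by simp⟩

/-- Balls of a periodic metric on a group of polynomial growth have polynomial volume growth. -/
theorem HasPolynomialGrowth.measure_oball_le [IsTopologicalGroup G] {μ : Measure G} {D : ℝ}
    (hG : HasPolynomialGrowth μ D) (hd : IsPeriodicMetric d) :
    ∃ C : ℝ, 0 < C ∧ ∀ r : ℝ, 1 ≤ r → μ (oball d r) ≤ ENNReal.ofReal (C * r ^ D) := by
  obtain ⟨hD, U, -, hU, hinv, hgen, C, hC1, hC⟩ := hG
  obtain ⟨s, hs, hgeo⟩ := hd.asymptotically_geodesic 1 one_pos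
  obtain ⟨k, hk⟩ := exists_subset_pow_of_isCompact hU hinv hgen (hd.proper (2 * s))
  have h1U : (1 : G) ∈ U := mem_of_mem_nhds hU
  refine ⟨C * ((k + 1 : ℕ) * (2 / s + 2)) ^ D, by positivity, fun r hr => ?_⟩
  have hr0 : 0 < r := by linarith
  -- Chains of length at most 2r give m + 1 letters with m s ≤ 2r; r ≥ 1 absorbs the extra letter.
  -- Letters are taken in `U ^ (k + 1)` to keep the exponent positive.
  set M : ℕ := ⌈(2 / s + 1) * r⌉₊
  have hM1 : (2 / s + 1) * r ≤ M := Nat.le_ceil _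
  have hM2 : (M : ℝ) ≤ (2 / s + 2) * r := by
    have := (Nat.ceil_lt_add_one (a := (2 / s + 1) * r) (by positivity)).le
    calc (M : ℝ) ≤ (2 / s + 1) * r + 1 := this
      _ ≤ _ := by linarith
  have hM0 : 0 < M := Nat.ceil_pos.2 (by positivity)
  have hsub : oball d r ⊆ U ^ ((k + 1) * M) := by
    intro x hx
    have hx' : d 1 x < r := by rw [hd.symm]; exact hx
    obtain ⟨n, p, hp0, hpn, hsum, hstep⟩ := hgeo 1 x
    obtain ⟨m, hm, hmem⟩ := hd.mem_pow_of_chain (V := U ^ (k + 1)) (s := s)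
      (fun y hy => Set.pow_subset_pow_right h1U (Nat.le_succ k) (hk (subset_closure hy)))
      hp0 hs.le hstep
    rw [hpn, ← pow_mul] at hmem
    refine Set.pow_subset_pow_right h1U (Nat.mul_le_mul_left _ ?_) hmem
    have h1 : (m : ℝ) * s ≤ 2 * r := by linarith
    have h2 : (m : ℝ) ≤ 2 * r / s := (le_div_iff₀ hs).2 h1
    have h3 : ((m + 1 : ℕ) : ℝ) ≤ M := by
      push_cast
      calc (m : ℝ) + 1 ≤ 2 * r / s + r := by linarith
        _ = (2 / s + 1) * r := by ring
        _ ≤ M := hM1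
    exact_mod_cast h3
  refine (measure_mono hsub).trans ((hC _ (Nat.mul_pos k.succ_pos hM0)).trans
    (ENNReal.ofReal_le_ofReal ?_))
  rw [mul_assoc, ← Real.mul_rpow (by positivity) hr0.le]
  push_cast
  gcongr ?_ * ?_ ^ D
  rw [mul_assoc]
  gcongr

/-- Negative powers of `1 + |x|` of order larger than the growth exponent are integrable. -/
lemma lintegral_one_add_rpow_neg_lt_top {μ : Measure G} {D C p : ℝ}
    (hd : IsPeriodicMetric d) (_hC : 0 < C)
    (hgrowth : ∀ r : ℝ, 1 ≤ r → μ (oball d r) ≤ ENNReal.ofReal (C * r ^ D)) (hD : 0 < D)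
    (hp : D < p) : ∫⁻ x, ENNReal.ofReal ((1 + d x 1) ^ (-p)) ∂μ < ⊤ := by
  -- Dyadic shells 2^k ≤ 1 + |x| < 2^(k+1) lead to a geometric series of ratio 2^(D-p) < 1.
  have hle : ∀ x, ENNReal.ofReal ((1 + d x 1) ^ (-p)) ≤ ∑' k : ℕ,
      (oball d (2 ^ (k + 1))).indicator (fun _ => ENNReal.ofReal (((2 : ℝ) ^ k) ^ (-p))) x := by
    intro x
    have h0 := hd.norm_nonneg x
    obtain ⟨k, hk1, hk2⟩ := exists_nat_pow_near (x := 1 + d x 1) (y := 2) (by linarith)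
      (by norm_num)
    refine le_trans ?_ (ENNReal.le_tsum k)
    have hx : x ∈ oball d (2 ^ (k + 1)) := by
      change d x 1 < _
      linarith
    rw [Set.indicator_of_mem hx]
    exact ENNReal.ofReal_le_ofReal
      (Real.rpow_le_rpow_of_nonpos (by positivity) hk1 (by linarith))
  refine (lintegral_mono hle).trans_lt ?_
  rw [lintegral_tsum fun k =>
    (measurable_const.indicator (hd.measurableSet_oball _)).aemeasurable]
  have hterm : ∀ k : ℕ, ∫⁻ x, (oball d (2 ^ (k + 1))).indicator
      (fun _ => ENNReal.ofReal (((2 : ℝ) ^ k) ^ (-p))) x ∂μ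
      ≤ ENNReal.ofReal (C * 2 ^ D * (2 ^ (D - p)) ^ k) := by
    intro k
    rw [lintegral_indicator_const (hd.measurableSet_oball _)]
    refine (mul_le_mul_right (hgrowth _ (one_le_pow₀ (by norm_num))) _).trans ?_
    rw [← ENNReal.ofReal_mul (by positivity)]
    refine le_of_eq (congrArg ENNReal.ofReal ?_)
    rw [← Real.rpow_natCast (2 : ℝ) k, ← Real.rpow_natCast (2 : ℝ) (k + 1), ← Real.rpow_mul,
      ← Real.rpow_mul, ← Real.rpow_natCast, ← Real.rpow_mul, mul_left_comm, mul_assoc,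
      ← Real.rpow_add, ← Real.rpow_add]
    · congr 2
      push_cast
      ring
    all_goals norm_num
  refine (ENNReal.tsum_le_tsum hterm).trans_lt ?_
  refine Summable.tsum_ofReal_lt_top (Summable.mul_left _ (summable_geometric_of_lt_one
    (by positivity) (Real.rpow_lt_one_of_one_lt_of_neg (by norm_num) (by linarith))))

variable {H : Type*} [NormedAddCommGroup H] [InnerProductSpace ℂ H]

/-- Polynomial off-diagonal decay of the matrix coefficient implies localization of the vector. -/
theorem mem_localizedVectors_of_decay [IsTopologicalGroup G] {μ : Measure G} {D : ℝ}
    (hG : HasPolynomialGrowth μ D) (hd : IsPeriodicMetric d) (π : ProjectiveRep G H) {g : H}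
    {C₀ α β : ℝ} (hα : 0 < α) (hβ : 0 < β)
    (h : ∀ x : G, ‖coeff π g g x‖ ≤ C₀ * (1 + d x 1) ^ (-((D + α + β) / 2)))
    {Q : Set G} (hQ : IsAdmissibleNhd Q) :
    g ∈ localizedVectors π μ Q (polyWeight d α) := by
  obtain ⟨C, hC, hgrowth⟩ := hG.measure_oball_le hd
  have hD := hG.1
  obtain ⟨ρ, hρ, hQρ⟩ := hd.exists_subset_oball hQ.2.1
  set e := (D + α + β) / 2 with he
  have he0 : 0 < e := by positivity
  have hC₀ : 0 ≤ C₀ := by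
    have h1 := (_root_.norm_nonneg _).trans (h 1)
    rw [hd.norm_one] at h1
    simpa using h1
  -- For z in `Q`, 1 + |x| ≤ (1 + ρ)(1 + |xz|), so the local maximum costs only a constant.
  have hmax : ∀ x, localMax Q (coeff π g g) x
      ≤ ENNReal.ofReal (C₀ * (1 + ρ) ^ e * (1 + d x 1) ^ (-e)) := by
    intro x
    refine iSup₂_le fun z hz => ?_
    rw [← ofReal_norm]
    refine ENNReal.ofReal_le_ofReal ((h _).trans ?_)
    rw [mul_assoc]
    refine mul_le_mul_of_nonneg_left ?_ hC₀
    have h1 := hd.norm_nonneg x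
    have h2 := hd.norm_nonneg (x * z)
    have h3 : d z 1 < ρ := hQρ (subset_closure hz)
    have h4 : d x 1 ≤ d (x * z) 1 + d z 1 := by
      have := hd.norm_mul_le (x * z) z⁻¹
      rwa [mul_inv_cancel_right, hd.norm_inv] at this
    have h5 : (1 + d x 1) / (1 + ρ) ≤ 1 + d (x * z) 1 := by
      rw [div_le_iff₀ (by positivity)]
      nlinarith
    refine (Real.rpow_le_rpow_of_nonpos (by positivity) h5 (by linarith)).trans (le_of_eq ?_)
    rw [Real.div_rpow (by positivity) (by positivity), Real.rpow_neg (by positivity : 0 ≤ 1 + ρ),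
      div_inv_eq_mul, mul_comm]
  have hfin := lintegral_one_add_rpow_neg_lt_top hd hC hgrowth hD (p := D + β) (by linarith)
  refine lt_of_le_of_lt (lintegral_mono fun x => ?_)
    (b := ∫⁻ x, ENNReal.ofReal ((C₀ * (1 + ρ) ^ e) ^ 2)
      * ENNReal.ofReal ((1 + d x 1) ^ (-(D + β))) ∂μ) ?_
  · have h1 := hd.norm_nonneg x
    refine (mul_le_mul_left (pow_le_pow_left₀ zero_le (hmax x) 2) _).trans ?_
    rw [← ENNReal.ofReal_pow (by positivity), ← ENNReal.ofReal_mul (by positivity),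
      ← ENNReal.ofReal_mul (by positivity)]
    refine le_of_eq (congrArg ENNReal.ofReal ?_)
    rw [polyWeight, mul_pow _ ((1 + d x 1) ^ (-e)), mul_assoc, ← Real.rpow_natCast _ 2,
      ← Real.rpow_natCast _ 2, ← Real.rpow_mul (by positivity : 0 ≤ 1 + d x 1),
      ← Real.rpow_add (by positivity)]
    congr 2
    simp only [he]
    push_cast
    ring
  · rw [lintegral_const_mul' _ _ ENNReal.ofReal_ne_top]
    exact ENNReal.mul_lt_top ENNReal.ofReal_lt_top hfin

end Geometry

/-! ### Counting and localization estimates -/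

section Estimates

variable {G : Type*} [Group G] [TopologicalSpace G] [MeasurableSpace G] {d : G → G → ℝ}
  {H : Type*} [NormedAddCommGroup H] [InnerProductSpace ℂ H]

lemma norm_coeff_op_right_symm (π : ProjectiveRep G H) (g : H) (t l : G) :
    ‖coeff π g (π.op t g) l‖ = ‖coeff π g g (l⁻¹ * t)‖ := by
  rw [norm_coeff_op_right, norm_coeff_swap, mul_inv_rev, inv_inv]

lemma measurable_ofReal_norm_sq_coeff (π : ProjectiveRep G H) (g f : H) :
    Measurable fun x => ENNReal.ofReal (‖coeff π g f x‖ ^ 2) :=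
  ((stronglyMeasurable_coeff π g f).norm.measurable.pow_const 2).ennreal_ofReal

lemma IsFrame.sum_le {π : ProjectiveRep G H} {g : H} {Λ : Set G} {A B : ℝ}
    (hF : IsFrame π g Λ A B) (u : Finset Λ) (v : H) :
    ∑ l ∈ u, ‖coeff π g v l‖ ^ 2 ≤ B * ‖v‖ ^ 2 :=
  ((hF v).1.sum_le_tsum u fun _ _ => by positivity).trans (hF v).2.2

lemma exists_setLIntegral_oball_pos {μ : Measure G} (hd : IsPeriodicMetric d)
    {f : G → ℝ≥0∞} (hf : ∫⁻ x, f x ∂μ ≠ 0) :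
    ∃ R : ℝ, 0 < ∫⁻ x in oball d R, f x ∂μ := by
  have hU : ⋃ n : ℕ, oball d (n : ℝ) = Set.univ :=
    Set.eq_univ_of_forall fun x => Set.mem_iUnion.2 (exists_nat_gt (d x 1))
  have h1 : (μ.withDensity f) (⋃ n : ℕ, oball d (n : ℝ)) ≠ 0 := by
    rwa [hU, withDensity_apply _ MeasurableSet.univ, Measure.restrict_univ]
  obtain ⟨n, hn⟩ := exists_measure_pos_of_not_measure_iUnion_null h1
  exact ⟨n, by rwa [withDensity_apply _ (hd.measurableSet_oball _)] at hn⟩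

lemma measurableSet_dist_lt (hd : IsPeriodicMetric d) (y : G) (r : ℝ) :
    MeasurableSet {t | d t y < r} :=
  (hd.measurable.comp (measurable_id.prodMk measurable_const)) measurableSet_Iio

omit [TopologicalSpace G] [MeasurableSpace G] in
lemma enorm_le_localMax {Q : Set G} (F : G → ℂ) (x : G) {z : G} (hz : z ∈ Q) :
    ‖F (x * z)‖ₑ ≤ localMax Q F x :=
  le_iSup₂ (f := fun z (_ : z ∈ Q) => ‖F (x * z)‖ₑ) z hz

omit [TopologicalSpace G] [MeasurableSpace G] in
lemma ofReal_norm_sq_le_localMax {Q : Set G} (F : G → ℂ) (x : G) {z : G} (hz : z ∈ Q) :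
    ENNReal.ofReal (‖F (x * z)‖ ^ 2) ≤ localMax Q F x ^ 2 := by
  rw [ENNReal.ofReal_pow (_root_.norm_nonneg _), ofReal_norm]
  exact pow_le_pow_left₀ zero_le (enorm_le_localMax F x hz) 2

/-- Tail bound for the square integral of the matrix coefficient. -/
lemma lintegral_coeff_tail_le {μ : Measure G} (π : ProjectiveRep G H) (g : H)
    {Q : Set G} (hQ : IsAdmissibleNhd Q) {α : ℝ} (hα : 0 < α) {s : ℝ} (hs : 0 < s) :
    (∫⁻ x, {x | s ≤ d x 1}.indicator (fun x => ENNReal.ofReal (‖coeff π g g x‖ ^ 2)) x ∂μ)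
        * ENNReal.ofReal (s ^ α)
      ≤ ∫⁻ x, localMax Q (coeff π g g) x ^ 2 * ENNReal.ofReal (polyWeight d α x) ∂μ := by
  rw [← lintegral_mul_const' _ _ ENNReal.ofReal_ne_top]
  refine lintegral_mono fun x => ?_
  by_cases hx : s ≤ d x 1
  · rw [Set.indicator_of_mem (show x ∈ {x | s ≤ d x 1} from hx)]
    refine mul_le_mul' ?_ (ENNReal.ofReal_le_ofReal
      (Real.rpow_le_rpow hs.le (by linarith) hα.le))
    simpa using ofReal_norm_sq_le_localMax (coeff π g g) x (mem_of_mem_nhds hQ.1)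
  · rw [Set.indicator_of_notMem (show x ∉ {x | s ≤ d x 1} from hx), zero_mul]
    exact zero_le

variable [IsTopologicalGroup G] [BorelSpace G] {μ : Measure G} [μ.IsMulLeftInvariant]

lemma measure_dist_lt (hd : IsPeriodicMetric d) (y : G) (r : ℝ) :
    μ {t | d t y < r} = μ (oball d r) := by
  rw [← measure_preimage_mul μ y⁻¹ (oball d r)]
  refine congrArg μ (Set.ext fun t => ?_)
  change d t y < r ↔ d (y⁻¹ * t) 1 < r
  rw [hd.dist_eq t y]

/-- The index set of a frame is relatively separated, with constants depending only on the
generator and the upper frame bound. -/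
theorem exists_card_le_of_frame [CompleteSpace H] [TopologicalSpace.SeparableSpace H]
    [IsFiniteMeasureOnCompacts μ] [μ.IsInvInvariant] [NeZero μ] {π : ProjectiveRep G H}
    (hπ : IsDiscreteSeries π μ) (hd : IsPeriodicMetric d) {g : H} (hg : g ≠ 0) (B ρ : ℝ) :
    ∃ N : ℝ≥0∞, N < ⊤ ∧ ∀ (Λ : Set G) (A : ℝ), IsFrame π g Λ A B → ∀ (y : G) (u : Finset Λ),
      (∀ l ∈ u, d (l : G) y < ρ) → (u.card : ℝ≥0∞) ≤ N := by
  obtain ⟨hpos, hint⟩ := hπ.lintegral_coeff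
  have hg0 : 0 < ‖g‖ := norm_pos_iff.2 hg
  set F : G → ℝ≥0∞ := fun x => ENNReal.ofReal (‖coeff π g g x‖ ^ 2)
  have hF0 : ∫⁻ x, F x ∂μ ≠ 0 := by
    rw [hint]
    exact (ENNReal.ofReal_pos.2 (by positivity)).ne'
  -- Each index near `y` contributes at least the mass `I` of |V_g g|² on B_R to the integral over
  -- `T` of ∑ |⟨π(t) g, π(l) g⟩|², whose integrand is at most B ‖g‖².
  obtain ⟨R, hR⟩ := exists_setLIntegral_oball_pos hd hF0
  set I := ∫⁻ x in oball d R, F x ∂μ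
  have hIfin : I ≠ ⊤ := by
    refine ne_top_of_le_ne_top ?_ (setLIntegral_le_lintegral _ _)
    rw [hint]
    exact ENNReal.ofReal_ne_top
  refine ⟨ENNReal.ofReal (B * ‖g‖ ^ 2) * μ (oball d (R + ρ)) / I,
    ENNReal.div_lt_top (ENNReal.mul_ne_top ENNReal.ofReal_ne_top
      (hd.measure_oball_lt_top μ _).ne) hR.ne', fun Λ A hF y u hu => ?_⟩
  rw [ENNReal.le_div_iff_mul_le (Or.inl hR.ne') (Or.inl hIfin)]
  set T : Set G := {t | d t y < R + ρ}
  have hT : MeasurableSet T := measurableSet_dist_lt hd y _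
  have h1 : ∀ l ∈ u, I ≤ ∫⁻ t in T, F ((l : G)⁻¹ * t) ∂μ := by
    intro l hl
    rw [← lintegral_indicator hT, ← lintegral_mul_left_eq_self _ (l : G)]
    simp only [I]
    rw [← lintegral_indicator (hd.measurableSet_oball R)]
    refine lintegral_mono fun s => ?_
    change (oball d R).indicator F s ≤ T.indicator (fun t => F ((l : G)⁻¹ * t)) ((l : G) * s)
    by_cases hs : s ∈ oball d R
    swap
    · rw [Set.indicator_of_notMem hs]
      exact zero_le
    rw [Set.indicator_of_mem hs]
    have h2 : (l : G) * s ∈ T := by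
      have h3 := hd.triangle ((l : G) * s) l y
      have h4 : d ((l : G) * s) l = d s 1 := by simpa using hd.left_invariant s 1 (l : G)
      have h5 : d s 1 < R := hs
      have h6 := hu l hl
      change d ((l : G) * s) y < R + ρ
      linarith
    rw [Set.indicator_of_mem h2, inv_mul_cancel_left]
  calc (u.card : ℝ≥0∞) * I = ∑ l ∈ u, I := by rw [Finset.sum_const, nsmul_eq_mul]
    _ ≤ ∑ l ∈ u, ∫⁻ t in T, F ((l : G)⁻¹ * t) ∂μ := Finset.sum_le_sum h1
    _ = ∫⁻ t in T, ∑ l ∈ u, F ((l : G)⁻¹ * t) ∂μ :=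
        (lintegral_finsetSum _ fun l _ =>
          (measurable_ofReal_norm_sq_coeff π g g).comp (measurable_const_mul _)).symm
    _ ≤ ∫⁻ _ in T, ENNReal.ofReal (B * ‖g‖ ^ 2) ∂μ := by
        refine lintegral_mono fun t => ?_
        simp only [F]
        rw [← ENNReal.ofReal_sum_of_nonneg fun _ _ => by positivity]
        refine ENNReal.ofReal_le_ofReal ?_
        simp only [← norm_coeff_op_right_symm]
        exact (hF.sum_le u (π.op t g)).trans_eq (by rw [LinearIsometryEquiv.norm_map])
    _ = ENNReal.ofReal (B * ‖g‖ ^ 2) * μ (oball d (R + ρ)) := by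
        rw [setLIntegral_const, measure_dist_lt hd]

/-- Sums of matrix coefficients over separated points far from `t` are controlled by the weighted
integral of the local maximal function. -/
theorem sum_coeff_le_lintegral_localMax (hd : IsPeriodicMetric d) (π : ProjectiveRep G H)
    {g : H} {Q : Set G} (hQ : IsAdmissibleNhd Q) {ρ : ℝ} (hρ : 0 < ρ) (hQρ : Q ⊆ oball d ρ)
    {α : ℝ} (hα : 0 < α) {N : ℝ≥0∞} (hN : N < ⊤) {ι : Type*} (u : Finset ι) (p : ι → G)
    (hcount : ∀ y : G, ∀ w ⊆ u, (∀ i ∈ w, d (p i) y < ρ) → (w.card : ℝ≥0∞) ≤ N)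
    {s : ℝ} (hs : 0 < s) (t : G) (hfar : ∀ i ∈ u, s ≤ d (p i) t) :
    (∑ i ∈ u, ENNReal.ofReal (‖coeff π g (π.op t g) (p i)‖ ^ 2)) * ENNReal.ofReal (s ^ α)
        * μ (interior Q)
      ≤ N * ENNReal.ofReal ((1 + ρ) ^ α) *
        ∫⁻ x, localMax Q (coeff π g g) x ^ 2 * ENNReal.ofReal (polyWeight d α x) ∂μ := by
  classical
  set a : ι → ℝ≥0∞ := fun i => ENNReal.ofReal (‖coeff π g (π.op t g) (p i)‖ ^ 2)
  -- Each term is spread over those y with p_i⁻¹ t y in `interior Q`, a measurable set of constant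
  -- measure. For such y, t⁻¹ p_i ∈ yQ, so the local maximum at y dominates the term, and at most
  -- `N` indices share a given y.
  have hpt : ∀ y, ∑ i ∈ u, a i * ENNReal.ofReal (s ^ α) *
      (interior Q).indicator 1 ((p i)⁻¹ * t * y)
      ≤ N * ENNReal.ofReal ((1 + ρ) ^ α) *
        (localMax Q (coeff π g g) y ^ 2 * ENNReal.ofReal (polyWeight d α y)) := by
    intro y
    set w := u.filter fun i => (p i)⁻¹ * t * y ∈ interior Q
    have hw : ∀ i ∈ w, i ∈ u ∧ (p i)⁻¹ * t * y ∈ interior Q := fun i hi =>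
      Finset.mem_filter.1 hi
    have hnear : ∀ i ∈ w, d (p i) (t * y) < ρ := by
      intro i hi
      have h1 : d ((p i)⁻¹ * t * y) 1 < ρ := hQρ (interior_subset (hw i hi).2)
      rwa [mul_assoc, ← hd.dist_eq, hd.symm] at h1
    have hterm : ∀ i ∈ w, a i * ENNReal.ofReal (s ^ α) ≤ ENNReal.ofReal ((1 + ρ) ^ α) *
        (localMax Q (coeff π g g) y ^ 2 * ENNReal.ofReal (polyWeight d α y)) := by
      intro i hi
      obtain ⟨hiu, hiQ⟩ := hw i hi
      have h1 : a i ≤ localMax Q (coeff π g g) y ^ 2 := by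
        have hz : ((p i)⁻¹ * t * y)⁻¹ ∈ Q := by
          rw [← hQ.2.2]
          exact Set.inv_mem_inv.2 (interior_subset hiQ)
        have h2 := ofReal_norm_sq_le_localMax (coeff π g g) y hz
        have h3 : y * ((p i)⁻¹ * t * y)⁻¹ = t⁻¹ * p i := by group
        simp only [a]
        rwa [norm_coeff_op_right, ← h3]
      have h2 : s ≤ (1 + ρ) * (1 + d y 1) := by
        have h3 := hd.triangle (p i) (t * y) t
        have h4 : d (t * y) t = d y 1 := by simpa using hd.left_invariant y 1 t
        nlinarith [hnear i hi, hfar i hiu, hd.norm_nonneg y]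
      have h5 : ENNReal.ofReal (s ^ α)
          ≤ ENNReal.ofReal ((1 + ρ) ^ α) * ENNReal.ofReal (polyWeight d α y) := by
        have h6 := hd.norm_nonneg y
        rw [← ENNReal.ofReal_mul (by positivity), polyWeight, ← Real.mul_rpow (by positivity)
          (by positivity)]
        exact ENNReal.ofReal_le_ofReal (Real.rpow_le_rpow hs.le h2 hα.le)
      exact (mul_le_mul' h1 h5).trans_eq (mul_left_comm _ _ _)
    calc ∑ i ∈ u, a i * ENNReal.ofReal (s ^ α) * (interior Q).indicator 1 ((p i)⁻¹ * t * y)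
        = ∑ i ∈ w, a i * ENNReal.ofReal (s ^ α) := by
          rw [Finset.sum_filter]
          refine Finset.sum_congr rfl fun i _ => ?_
          split_ifs with h
          · rw [Set.indicator_of_mem h, Pi.one_apply, mul_one]
          · rw [Set.indicator_of_notMem h, mul_zero]
      _ ≤ w.card • _ := Finset.sum_le_card_nsmul _ _ _ hterm
      _ ≤ _ := by
          rw [nsmul_eq_mul, mul_assoc]
          exact mul_le_mul_left (hcount (t * y) w (Finset.filter_subset _ _) hnear) _
  rw [← lintegral_const_mul' _ _ (ENNReal.mul_ne_top hN.ne ENNReal.ofReal_ne_top)]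
  refine le_trans (le_of_eq ?_) (lintegral_mono hpt)
  have hmeas : Measurable ((interior Q).indicator (1 : G → ℝ≥0∞)) :=
    measurable_one.indicator isOpen_interior.measurableSet
  have hmeas' : ∀ i, Measurable fun y =>
      a i * ENNReal.ofReal (s ^ α) * (interior Q).indicator 1 ((p i)⁻¹ * t * y) := fun i =>
    (hmeas.comp (measurable_const_mul ((p i)⁻¹ * t))).const_mul _
  rw [lintegral_finsetSum _ fun i _ => hmeas' i, Finset.sum_mul, Finset.sum_mul]
  refine Finset.sum_congr rfl fun i _ => ?_
  rw [lintegral_const_mul' _ _ (ENNReal.mul_ne_top ENNReal.ofReal_ne_top ENNReal.ofReal_ne_top),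
    lintegral_mul_left_eq_self (μ := μ) ((interior Q).indicator 1) ((p i)⁻¹ * t),
    lintegral_indicator_one isOpen_interior.measurableSet]

/-- Uniform tail bound for the frame coefficients of `π(t) g`. -/
theorem exists_sum_coeff_le [CompleteSpace H] [TopologicalSpace.SeparableSpace H]
    [μ.IsOpenPosMeasure] [IsFiniteMeasureOnCompacts μ] [μ.IsInvInvariant] [NeZero μ]
    {π : ProjectiveRep G H} (hπ : IsDiscreteSeries π μ) (hd : IsPeriodicMetric d)
    {g : H} (hg : g ≠ 0) {Q : Set G} (hQ : IsAdmissibleNhd Q) {α : ℝ} (hα : 0 < α)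
    (hgQ : g ∈ localizedVectors π μ Q (polyWeight d α)) (B : ℝ) :
    ∃ C : ℝ, 0 ≤ C ∧ ∀ (Λ : Set G) (A : ℝ), IsFrame π g Λ A B → ∀ (t : G) (s : ℝ), 0 < s →
      ∀ u : Finset Λ, (∀ l ∈ u, s ≤ d (l : G) t) →
        ∑ l ∈ u, ‖coeff π g (π.op t g) l‖ ^ 2 ≤ C * s ^ (-α) := by
  obtain ⟨ρ, hρ, hQρ⟩ := hd.exists_subset_oball hQ.2.1
  obtain ⟨N, hN, hcard⟩ := exists_card_le_of_frame hπ hd hg B ρ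
  set M := ∫⁻ x, localMax Q (coeff π g g) x ^ 2 * ENNReal.ofReal (polyWeight d α x) ∂μ with hMdef
  have hM : M < ⊤ := hgQ
  set m := μ (interior Q)
  have hm0 : m ≠ 0 := (isOpen_interior.measure_pos μ ⟨1, mem_interior_iff_mem_nhds.2 hQ.1⟩).ne'
  have hm : m ≠ ⊤ := ((measure_mono (interior_subset.trans subset_closure)).trans_lt
    hQ.2.1.measure_lt_top).ne
  set K := N * ENNReal.ofReal ((1 + ρ) ^ α) * M / m
  have hK : K ≠ ⊤ := (ENNReal.div_lt_top (ENNReal.mul_ne_top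
    (ENNReal.mul_ne_top hN.ne ENNReal.ofReal_ne_top) hM.ne) hm0).ne
  refine ⟨K.toReal, ENNReal.toReal_nonneg, fun Λ A hF t s hs u hu => ?_⟩
  have h1 := sum_coeff_le_lintegral_localMax (μ := μ) hd π (g := g) hQ hρ
    (subset_closure.trans hQρ) hα hN u (fun l : Λ => (l : G))
    (fun y w _ hw => hcard Λ A hF y w hw) hs t hu
  rw [← hMdef, ← ENNReal.le_div_iff_mul_le (Or.inl hm0) (Or.inl hm),
    ← ENNReal.ofReal_sum_of_nonneg (fun _ _ => by positivity),
    ← ENNReal.ofReal_mul (Finset.sum_nonneg fun _ _ => by positivity)] at h1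
  have h2 := (ENNReal.ofReal_le_iff_le_toReal hK).1 h1
  rw [Real.rpow_neg hs.le, ← div_eq_mul_inv, le_div_iff₀ (by positivity)]
  exact h2

end Estimates

/-! ### Comparison of counting functions with volumes of balls -/

section Comparison

variable {G : Type*} [Group G] [TopologicalSpace G] [MeasurableSpace G] {d : G → G → ℝ}
  {H : Type*} [NormedAddCommGroup H] [InnerProductSpace ℂ H] [CompleteSpace H]
  [TopologicalSpace.SeparableSpace H]
  [IsTopologicalGroup G] [BorelSpace G] {μ : Measure G} [μ.IsMulLeftInvariant]
  [μ.IsOpenPosMeasure] [IsFiniteMeasureOnCompacts μ] [μ.IsInvInvariant] [NeZero μ]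
  {π : ProjectiveRep G H}

/-- A frame has at least about `dπ μ(B_{R-s})` points in any ball of radius `R`. -/
theorem exists_frame_card_bound (hπ : IsDiscreteSeries π μ) (hd : IsPeriodicMetric d) {g : H}
    (hg : g ≠ 0) {Q : Set G} (hQ : IsAdmissibleNhd Q) {α : ℝ} (hα : 0 < α)
    (hgQ : g ∈ localizedVectors π μ Q (polyWeight d α)) {A B : ℝ} (hA : 0 < A) :
    ∃ C : ℝ, 0 ≤ C ∧ ∀ Λ : Set G, IsFrame π g Λ A B → ∀ (x : G) (R s : ℝ), 0 < s →
      ∀ S : Finset Λ, (∀ l : Λ, d (l : G) x < R → l ∈ S) →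
        formalDegree π μ * (μ.real (oball d (R - s)) * (1 - C * s ^ (-α))) ≤ S.card := by
  obtain ⟨C, hC0, hC⟩ := exists_sum_coeff_le hπ hd hg hQ hα hgQ B
  obtain ⟨hpos, -⟩ := hπ.lintegral_coeff
  have hg0 : 0 < ‖g‖ := norm_pos_iff.2 hg
  refine ⟨C / (A * ‖g‖ ^ 2), by positivity, fun Λ hF x R s hs S hS => ?_⟩
  obtain ⟨W, hfd, hdim, hW⟩ := hF.exists_subspace hA S
  set κ : ℝ := ‖g‖ ^ 2 - C * s ^ (-α) / A
  have hκ : ∀ t ∈ {t | d t x < R - s}, κ ≤ ‖W.starProjection (π.op t g)‖ ^ 2 := by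
    intro t ht
    have ht' : d t x < R - s := ht
    have h1 := hW (π.op t g) (C * s ^ (-α)) fun u hu => hC Λ A hF t s hs u fun l hl => by
      have h2 : R ≤ d (l : G) x := by
        by_contra h3
        exact Finset.disjoint_left.1 hu hl (hS l (not_le.1 h3))
      have h4 := hd.triangle (l : G) t x
      linarith
    rw [LinearIsometryEquiv.norm_map] at h1
    have h2 : ‖g‖ ^ 2 - ‖W.starProjection (π.op t g)‖ ^ 2 ≤ C * s ^ (-α) / A := by
      rw [le_div_iff₀ hA, mul_comm]
      exact h1
    simp only [κ]
    linarith
  -- For small `s` the number `κ` may be negative; `ENNReal.ofReal` then makes this bound trivial.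
  have h1 : ENNReal.ofReal κ * μ (oball d (R - s))
      ≤ ENNReal.ofReal ((formalDegree π μ)⁻¹ * ‖g‖ ^ 2 * Module.finrank ℂ W) := by
    rw [← hπ.lintegral_norm_sq_starProjection g W, ← measure_dist_lt hd x, ← setLIntegral_const]
    refine (setLIntegral_mono' (measurableSet_dist_lt hd x _) fun t ht =>
      ENNReal.ofReal_le_ofReal (hκ t ht)).trans (setLIntegral_le_lintegral _ _)
  rw [← ENNReal.ofReal_toReal (hd.measure_oball_lt_top μ (R - s)).ne,
    ← ENNReal.ofReal_mul' ENNReal.toReal_nonneg,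
    ENNReal.ofReal_le_ofReal_iff (by positivity)] at h1
  have h2 : (Module.finrank ℂ W : ℝ) ≤ S.card := by exact_mod_cast hdim
  refine le_trans ?_ h2
  have h3 : κ = ‖g‖ ^ 2 * (1 - C / (A * ‖g‖ ^ 2) * s ^ (-α)) := by
    simp only [κ]
    field_simp
  rw [h3] at h1
  have h4 : ‖g‖ ^ 2 * (μ.real (oball d (R - s)) * (1 - C / (A * ‖g‖ ^ 2) * s ^ (-α)))
      ≤ ‖g‖ ^ 2 * ((formalDegree π μ)⁻¹ * Module.finrank ℂ W) := by
    rw [measureReal_def]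
    linarith
  have h5 := le_of_mul_le_mul_left h4 (by positivity)
  rwa [inv_mul_eq_div, le_div_iff₀' hpos] at h5

omit [μ.IsOpenPosMeasure] in
/-- A Riesz sequence has at most about `dπ μ(B_{R+s})` points in any ball of radius `R`. -/
theorem exists_riesz_card_bound (hπ : IsDiscreteSeries π μ) (hd : IsPeriodicMetric d) {g : H}
    (hg : g ≠ 0) {Q : Set G} (hQ : IsAdmissibleNhd Q) {α : ℝ} (hα : 0 < α)
    (hgQ : g ∈ localizedVectors π μ Q (polyWeight d α)) {A B : ℝ} (hA : 0 < A) :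
    ∃ C : ℝ, 0 ≤ C ∧ ∀ Λ : Set G, IsRieszSequence π g Λ A B → ∀ (x : G) (R s : ℝ), 0 < s →
      ∀ S : Finset Λ, (∀ l ∈ S, d (l : G) x < R) →
        S.card * (1 - C * s ^ (-α)) ≤ formalDegree π μ * μ.real (oball d (R + s)) := by
  obtain ⟨hpos, -⟩ := hπ.lintegral_coeff
  have hg0 : 0 < ‖g‖ := norm_pos_iff.2 hg
  set M := ∫⁻ x, localMax Q (coeff π g g) x ^ 2 * ENNReal.ofReal (polyWeight d α x) ∂μ with hMdef
  have hM : M ≠ ⊤ := ne_of_lt hgQ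
  refine ⟨formalDegree π μ * M.toReal / (A * ‖g‖ ^ 2), by positivity,
    fun Λ hR x R s hs S hS => ?_⟩
  obtain ⟨W, hfd, hdim, hW⟩ := hR.exists_subspace hA S
  set F : G → ℝ≥0∞ := {x | s ≤ d x 1}.indicator fun x => ENNReal.ofReal (‖coeff π g g x‖ ^ 2)
  have hFm : Measurable F := (measurable_ofReal_norm_sq_coeff π g g).indicator
    (hd.measurable_norm measurableSet_Ici)
  have hFint : ∫⁻ t, F t ∂μ ≤ ENNReal.ofReal (M.toReal * s ^ (-α)) := by
    have h1 := lintegral_coeff_tail_le (μ := μ) (d := d) π g hQ hα hs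
    have h2 : ENNReal.ofReal (s ^ α) ≠ 0 := (ENNReal.ofReal_pos.2 (by positivity)).ne'
    rw [← hMdef, ← ENNReal.le_div_iff_mul_le (Or.inl h2) (Or.inl ENNReal.ofReal_ne_top)] at h1
    refine h1.trans_eq ?_
    rw [Real.rpow_neg hs.le, ← div_eq_mul_inv, ENNReal.ofReal_div_of_pos (by positivity),
      ENNReal.ofReal_toReal hM]
  set T : Set G := {t | d t x < R + s}
  have hT : MeasurableSet T := measurableSet_dist_lt hd x _
  -- Inside `T` the projection has norm at most ‖g‖. Outside, every point of `S` is at distance at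
  -- least `s` from t, so only tails of the coefficient enter.
  have hpt : ∀ t, ENNReal.ofReal (‖W.starProjection (π.op t g)‖ ^ 2)
      ≤ T.indicator (fun _ => ENNReal.ofReal (‖g‖ ^ 2)) t
        + ENNReal.ofReal A⁻¹ * ∑ l ∈ S, F ((l : G)⁻¹ * t) := by
    intro t
    by_cases ht : t ∈ T
    · rw [Set.indicator_of_mem ht]
      refine le_trans (ENNReal.ofReal_le_ofReal (pow_le_pow_left₀ (_root_.norm_nonneg _) ?_ 2))
        le_self_add
      exact (W.norm_starProjection_apply_le _).trans_eq (LinearIsometryEquiv.norm_map _ _)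
    · rw [Set.indicator_of_notMem ht, zero_add]
      have h1 : ∀ l ∈ S, F ((l : G)⁻¹ * t)
          = ENNReal.ofReal (‖coeff π g (π.op t g) l‖ ^ 2) := by
        intro l hl
        have h2 : s ≤ d ((l : G)⁻¹ * t) 1 := by
          rw [← hd.dist_eq]
          have h3 := hd.triangle t l x
          have h4 := hS l hl
          have h5 : R + s ≤ d t x := not_lt.1 ht
          linarith
        simp only [F]
        rw [Set.indicator_of_mem (show (l : G)⁻¹ * t ∈ {x | s ≤ d x 1} from h2),
          norm_coeff_op_right_symm]
      rw [Finset.sum_congr rfl h1, ← ENNReal.ofReal_sum_of_nonneg (fun _ _ => by positivity),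
        ← ENNReal.ofReal_mul (by positivity)]
      refine ENNReal.ofReal_le_ofReal ?_
      rw [inv_mul_eq_div, le_div_iff₀' hA]
      exact hW _
  have hFm' : ∀ l : Λ, Measurable fun t => F ((l : G)⁻¹ * t) := fun l =>
    hFm.comp (measurable_const_mul _)
  have h1 : ENNReal.ofReal ((formalDegree π μ)⁻¹ * ‖g‖ ^ 2 * Module.finrank ℂ W)
      ≤ ENNReal.ofReal (‖g‖ ^ 2 * μ.real (oball d (R + s))
        + A⁻¹ * (S.card * (M.toReal * s ^ (-α)))) := by
    rw [← hπ.lintegral_norm_sq_starProjection g W]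
    refine (lintegral_mono hpt).trans ?_
    rw [lintegral_add_left (measurable_const.indicator hT), lintegral_indicator_const hT,
      lintegral_const_mul' _ _ ENNReal.ofReal_ne_top,
      lintegral_finsetSum _ fun l _ => hFm' l,
      ENNReal.ofReal_add (by positivity) (by positivity), measure_dist_lt hd,
      ENNReal.ofReal_mul (by positivity), ENNReal.ofReal_mul (by positivity),
      ofReal_measureReal (hd.measure_oball_lt_top μ _).ne]
    refine add_le_add le_rfl (mul_le_mul_right ?_ _)
    rw [ENNReal.ofReal_mul (by positivity), ENNReal.ofReal_natCast, ← nsmul_eq_mul]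
    refine Finset.sum_le_card_nsmul _ _ _ fun l _ => ?_
    rw [lintegral_mul_left_eq_self (μ := μ) F]
    exact hFint
  rw [ENNReal.ofReal_le_ofReal_iff (by positivity), hdim] at h1
  have h2 : ‖g‖ ^ 2 * (S.card * (1 - formalDegree π μ * M.toReal / (A * ‖g‖ ^ 2) * s ^ (-α)))
      = formalDegree π μ * ((formalDegree π μ)⁻¹ * ‖g‖ ^ 2 * S.card
        - A⁻¹ * (S.card * (M.toReal * s ^ (-α)))) := by
    field_simp
  refine le_of_mul_le_mul_left ?_ (show 0 < ‖g‖ ^ 2 by positivity)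
  refine h2.trans_le ((mul_le_mul_of_nonneg_left
    (c := ‖g‖ ^ 2 * μ.real (oball d (R + s))) ?_ hpos.le).trans_eq (mul_left_comm _ _ _))
  linarith

end Comparison

/-! ### Asymptotics in the radius -/

section Asymptotics

variable {G : Type*} [Group G] [TopologicalSpace G] [MeasurableSpace G] {d : G → G → ℝ}

omit [MeasurableSpace G] in
lemma IsAssociatedRadii.tendsto_atTop {r : ℕ → ℝ} (hr : IsAssociatedRadii d r) :
    Filter.Tendsto r Filter.atTop Filter.atTop := by
  obtain ⟨hpos, r₀, hr₀, -, hstep⟩ := hr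
  have h1 : ∀ n : ℕ, (n : ℝ) * r₀ ≤ r n := by
    intro n
    induction n with
    | zero => simpa using (hpos 0).le
    | succ n ih =>
      have := hstep n
      push_cast
      linarith
  exact Filter.tendsto_atTop_mono h1 (tendsto_natCast_atTop_atTop.atTop_mul_const hr₀)

lemma AnnularDecay.real_le {μ : Measure G} [IsFiniteMeasureOnCompacts μ]
    (hd : IsPeriodicMetric d) {c δ : ℝ} (hc : 0 < c)
    (h : ∀ r s : ℝ, 1 ≤ r → 0 < s → s ≤ r →
      μ (oball d r \ oball d (r - s)) ≤ ENNReal.ofReal (c * (s / r) ^ δ) * μ (oball d r))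
    {r s : ℝ} (hr : 1 ≤ r) (hs : 0 < s) (hsr : s ≤ r) :
    μ.real (oball d r) * (1 - c * (s / r) ^ δ) ≤ μ.real (oball d (r - s)) := by
  have hfin := fun r => (hd.measure_oball_lt_top μ r).ne
  have h1 := ENNReal.toReal_mono (ENNReal.mul_ne_top ENNReal.ofReal_ne_top (hfin r))
    (h r s hr hs hsr)
  rw [ENNReal.toReal_mul, ENNReal.toReal_ofReal (by positivity), ← measureReal_def,
    ← measureReal_def] at h1
  have hsub : oball d (r - s) ⊆ oball d r := fun x hx =>
    lt_of_lt_of_le (show d x 1 < r - s from hx) (by linarith)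
  rw [measureReal_sdiff hsub (hd.measurableSet_oball _) (hfin _)] at h1
  linarith

/-- The scale `s = r^{δ/(δ+α)}` balances the two error terms. -/
lemma exists_radius_scale {α δ : ℝ} (hα : 0 < α) (hδ : 0 < δ) (hδ1 : δ ≤ 1) (ρ : ℝ) {κ : ℝ}
    (hκ : 0 < κ) :
    ∃ r₁ : ℝ, 1 ≤ r₁ ∧ ∀ r, r₁ ≤ r → ∃ s : ℝ, 0 < s ∧ ρ ≤ s ∧ s ≤ r ∧
      s ^ (-α) = r ^ (-(α * δ / (δ + α))) ∧ r ^ (-(α * δ / (δ + α))) ≤ κ ∧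
      ∀ R t, 0 ≤ t → t ≤ 2 * s → r ≤ R → (t / R) ^ δ ≤ 2 * r ^ (-(α * δ / (δ + α))) := by
  have hη : 0 < α * δ / (δ + α) := by positivity
  have hθ : 0 < δ / (δ + α) := by positivity
  have h1 : ∀ᶠ r : ℝ in Filter.atTop, ρ ≤ r ^ (δ / (δ + α)) :=
    (tendsto_rpow_atTop hθ).eventually_ge_atTop ρ
  have h2 : ∀ᶠ r : ℝ in Filter.atTop, r ^ (-(α * δ / (δ + α))) ≤ κ :=
    ((tendsto_rpow_neg_atTop hη).eventually_lt_const hκ).mono fun _ h => h.le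
  obtain ⟨r₁, hr₁⟩ := Filter.eventually_atTop.1 (h1.and h2)
  refine ⟨max 1 r₁, le_max_left _ _, fun r hr => ?_⟩
  have hr1 : 1 ≤ r := (le_max_left _ _).trans hr
  have hr0 : 0 < r := by linarith
  obtain ⟨h3, h4⟩ := hr₁ r ((le_max_right _ _).trans hr)
  -- With θ = δ/(δ+α), αθ = δ(1 - θ). The range t ≤ 2s leaves room for the extra `ρ` caused by
  -- closures.
  refine ⟨r ^ (δ / (δ + α)), by positivity, h3, ?_, ?_, h4, fun R t ht hts hR => ?_⟩
  · exact (Real.rpow_le_rpow_of_exponent_le hr1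
      ((div_le_one (by positivity)).2 (by linarith))).trans_eq (Real.rpow_one r)
  · rw [← Real.rpow_mul hr0.le]
    congr 1
    ring
  · have h5 : t / R ≤ 2 * r ^ (δ / (δ + α) - 1) := by
      rw [Real.rpow_sub hr0, Real.rpow_one, ← mul_div_assoc]
      gcongr
    calc (t / R) ^ δ ≤ (2 * r ^ (δ / (δ + α) - 1)) ^ δ := by
          have : 0 < R := by linarith
          gcongr
      _ = 2 ^ δ * r ^ (-(α * δ / (δ + α))) := by
          rw [Real.mul_rpow (by norm_num) (by positivity), ← Real.rpow_mul hr0.le]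
          congr 2
          field_simp
          ring
      _ ≤ 2 * r ^ (-(α * δ / (δ + α))) := by
          gcongr
          exact (Real.rpow_le_rpow_of_exponent_le (by norm_num) hδ1).trans_eq (Real.rpow_one 2)

omit [Group G] [TopologicalSpace G] [MeasurableSpace G] in
lemma card_le_encard {Λ T : Set G} (S : Finset Λ) (hS : ∀ l ∈ S, (l : G) ∈ T) :
    (S.card : ℝ≥0∞) ≤ ((Λ ∩ T).encard : ℝ≥0∞) := by
  have h1 : ((S.map (Function.Embedding.subtype _) : Finset G) : Set G) ⊆ Λ ∩ T := by
    intro x hx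
    obtain ⟨l, hl, rfl⟩ := Finset.mem_map.1 (Finset.mem_coe.1 hx)
    exact ⟨l.2, hS l hl⟩
  have h2 := Set.encard_le_encard h1
  rw [Set.encard_coe_eq_coe_finsetCard, Finset.card_map] at h2
  exact_mod_cast ENat.toENNReal_le.2 h2

omit [Group G] [TopologicalSpace G] [MeasurableSpace G] in
-- An infinite intersection satisfies any lower bound, so only finite ones need the hypothesis.
lemma le_encard_of_forall_finset {Λ T : Set G} {q : ℝ}
    (h : ∀ S : Finset Λ, (∀ l : Λ, (l : G) ∈ T ↔ l ∈ S) → q ≤ S.card) :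
    ENNReal.ofReal q ≤ ((Λ ∩ T).encard : ℝ≥0∞) := by
  classical
  by_cases hfin : {l : Λ | (l : G) ∈ T}.Finite
  · have h1 := h hfin.toFinset fun l => by simp
    refine le_trans ?_ (card_le_encard hfin.toFinset fun l hl => by simpa using hl)
    rw [← ENNReal.ofReal_natCast]
    exact ENNReal.ofReal_le_ofReal h1
  · have h2 : (Λ ∩ T).encard = ⊤ := by
      refine Set.encard_eq_top fun hf => hfin ?_
      refine Set.Finite.of_finite_image (f := Subtype.val) (hf.subset ?_)
        Subtype.val_injective.injOn
      rintro _ ⟨l, hl, rfl⟩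
      exact ⟨l.2, hl⟩
    rw [h2]
    exact le_top

omit [Group G] [TopologicalSpace G] [MeasurableSpace G] in
-- An infinite intersection would contain finite subsets of every size, against the bound `q`.
lemma encard_le_of_forall_finset {Λ T : Set G} {q : ℝ}
    (h : ∀ S : Finset Λ, (∀ l ∈ S, (l : G) ∈ T) → (S.card : ℝ) ≤ q) :
    ((Λ ∩ T).encard : ℝ≥0∞) ≤ ENNReal.ofReal q := by
  classical
  have key : ∀ F : Finset G, (F : Set G) ⊆ Λ ∩ T → (F.card : ℝ) ≤ q := by
    intro F hF
    have h1 := h (F.subtype (· ∈ Λ)) fun l hl => (hF (Finset.mem_subtype.1 hl)).2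
    rwa [Finset.card_subtype, Finset.filter_true_of_mem fun x hx => (hF hx).1] at h1
  have hfin : (Λ ∩ T).Finite := by
    by_contra hinf
    obtain ⟨n, hn⟩ := exists_nat_gt q
    obtain ⟨F, hF, hcard⟩ := Set.Infinite.exists_subset_card_eq hinf n
    have := key F hF
    rw [hcard] at this
    linarith
  have h1 := key hfin.toFinset (by simp)
  rw [← hfin.coe_toFinset, Set.encard_coe_eq_coe_finsetCard, ENat.toENNReal_coe,
    ← ENNReal.ofReal_natCast]
  exact ENNReal.ofReal_le_ofReal h1

lemma mem_smul_oball (hd : IsPeriodicMetric d) (x y : G) (r : ℝ) :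
    y ∈ x • oball d r ↔ d y x < r := by
  rw [Set.mem_smul_set_iff_inv_smul_mem, smul_eq_mul, hd.dist_eq y x]
  rfl

end Asymptotics

/-! ### Density estimates for large radii. -/

section Density

variable {G : Type*} [Group G] [TopologicalSpace G] [IsTopologicalGroup G]
  [LocallyCompactSpace G] [MeasurableSpace G] [BorelSpace G] {d : G → G → ℝ}
  {H : Type*} [NormedAddCommGroup H] [InnerProductSpace ℂ H] [CompleteSpace H]
  [TopologicalSpace.SeparableSpace H] {μ : Measure G} [μ.IsHaarMeasure] [μ.IsInvInvariant]
  {π : ProjectiveRep G H}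

omit [IsTopologicalGroup G] [LocallyCompactSpace G] [BorelSpace G] [μ.IsInvInvariant] in
lemma measure_closure_oball_ne_zero {r ρ : ℝ} (hρ : oball d ρ ∈ 𝓝 (1 : G)) (hr : ρ ≤ r) :
    μ (closure (oball d r)) ≠ 0 := by
  have h1 : oball d r ∈ 𝓝 (1 : G) :=
    Filter.mem_of_superset hρ fun x hx => lt_of_lt_of_le hx hr
  exact (Measure.measure_pos_of_mem_nhds μ (Filter.mem_of_superset h1 subset_closure)).ne'

/-- Annular decay compares B_(r-s) with B_(r+ρ), which contains the closure of B_r; then (1 - 2cq)(1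
- C₁q) ≥ 1 - (2c + C₁)q. -/
theorem frame_density (hπ : IsDiscreteSeries π μ) (hd : IsPeriodicMetric d) {δ : ℝ}
    (hδ : AnnularDecay μ d δ) {g : H} {Q : Set G} (hQ : IsAdmissibleNhd Q) {α : ℝ} (hα : 0 < α)
    (hgQ : g ∈ localizedVectors π μ Q (polyWeight d α)) {A B : ℝ} (hA : 0 < A) :
    ∃ C : ℝ, 0 < C ∧ ∃ r₁ : ℝ, ∀ r, r₁ ≤ r → ∀ Λ : Set G, IsFrame π g Λ A B → ∀ x : G,
      ENNReal.ofReal (formalDegree π μ * (1 - C * r ^ (-(α * δ / (δ + α)))))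
        ≤ countingRatio μ Λ (closure (oball d r)) x := by
  obtain ⟨hpos, -⟩ := hπ.lintegral_coeff
  rcases eq_or_ne g 0 with rfl | hg
  · refine ⟨1, one_pos, 0, fun r _ Λ hF => ?_⟩
    exfalso
    obtain ⟨-, h, hh, -⟩ := hπ
    have h1 := (hF h).2.1
    have h2 : ∀ l, coeff π (0 : H) h l = 0 := fun l => by simp [coeff]
    simp only [h2, norm_zero, zero_pow two_ne_zero, tsum_zero] at h1
    have h3 : 0 < ‖h‖ := norm_pos_iff.2 hh
    have h4 : 0 < A * ‖h‖ ^ 2 := by positivity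
    linarith
  obtain ⟨hδ0, hδ1, c, hc, hann⟩ := hδ
  obtain ⟨ρ, hρ, hρn⟩ := hd.exists_oball_mem_nhds
  obtain ⟨C₁, hC₁, hmain⟩ := exists_frame_card_bound (B := B) hπ hd hg hQ hα hgQ hA
  obtain ⟨r₁, hr₁, hscale⟩ := exists_radius_scale hα hδ0 hδ1 ρ one_pos
  refine ⟨2 * c + C₁, by positivity, max r₁ ρ, fun r hr Λ hF x => ?_⟩
  obtain ⟨s, hs, hρs, hsr, hsα, -, hsδ⟩ := hscale r ((le_max_left _ _).trans hr)
  have hr0 : 1 ≤ r := hr₁.trans ((le_max_left _ _).trans hr)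
  set q := r ^ (-(α * δ / (δ + α)))
  have hq0 : 0 ≤ q := by positivity
  have hm0 : μ (closure (oball d r)) ≠ 0 :=
    measure_closure_oball_ne_zero hρn ((le_max_right _ _).trans hr)
  have hsub := hd.closure_oball_subset hρn r
  have hmle : μ (closure (oball d r)) ≤ μ (oball d (r + ρ)) := measure_mono hsub
  have hm : μ (closure (oball d r)) ≠ ⊤ :=
    (hmle.trans_lt (hd.measure_oball_lt_top μ _)).ne
  -- A negative lower bound becomes 0 in `ℝ≥0∞`. Otherwise 1 - C₁q ≥ 0, as the final multiplication
  -- requires.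
  rcases le_total (1 - (2 * c + C₁) * q) 0 with hneg | hnn
  · rw [ENNReal.ofReal_of_nonpos (mul_nonpos_of_nonneg_of_nonpos hpos.le hneg)]
    exact zero_le
  rw [countingRatio, ENNReal.le_div_iff_mul_le (Or.inl hm0) (Or.inl hm),
    ← ofReal_measureReal hm, ← ENNReal.ofReal_mul (by positivity)]
  refine le_encard_of_forall_finset fun S hS => ?_
  have h1 := hmain Λ hF x r s hs S fun l hl => (hS l).1
    (Set.smul_set_mono subset_closure ((mem_smul_oball hd x l r).2 hl))
  rw [hsα] at h1
  refine le_trans ?_ h1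
  rw [mul_assoc]
  refine mul_le_mul_of_nonneg_left ?_ hpos.le
  have h2 := AnnularDecay.real_le hd hc hann (r := r + ρ) (s := s + ρ) (by linarith) (by linarith)
    (by linarith)
  rw [add_sub_add_right_eq_sub] at h2
  have h3 := hsδ (r + ρ) (s + ρ) (by linarith) (by linarith) (by linarith)
  set V := μ.real (oball d (r + ρ))
  have hV0 : 0 ≤ V := measureReal_nonneg
  have h4 : V * (1 - 2 * c * q) ≤ μ.real (oball d (r - s)) := by
    refine le_trans (mul_le_mul_of_nonneg_left ?_ hV0) h2
    nlinarith
  have hVle : μ.real (closure (oball d r)) ≤ V :=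
    ENNReal.toReal_mono (hd.measure_oball_lt_top μ _).ne hmle
  have h5 : 0 ≤ 1 - C₁ * q := by nlinarith [mul_nonneg hc.le hq0]
  calc (1 - (2 * c + C₁) * q) * μ.real (closure (oball d r))
      ≤ (1 - (2 * c + C₁) * q) * V := mul_le_mul_of_nonneg_left hVle hnn
    _ ≤ V * (1 - 2 * c * q) * (1 - C₁ * q) := by
        nlinarith [mul_nonneg hV0 (mul_nonneg (mul_nonneg hc.le hq0) (mul_nonneg hC₁ hq0))]
    _ ≤ μ.real (oball d (r - s)) * (1 - C₁ * q) := mul_le_mul_of_nonneg_right h4 h5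

/-- Points in the closure of B_r are counted in B_(r+ρ), and annular decay leads from B_(r+ρ+s) back
to B_r. Large r makes u = (2c + C₁)q at most 1/2, where 1/(1 - u) ≤ 1 + 2u. -/
theorem riesz_density (hπ : IsDiscreteSeries π μ) (hd : IsPeriodicMetric d) {δ : ℝ}
    (hδ : AnnularDecay μ d δ) {g : H} {Q : Set G} (hQ : IsAdmissibleNhd Q) {α : ℝ} (hα : 0 < α)
    (hgQ : g ∈ localizedVectors π μ Q (polyWeight d α)) {A B : ℝ} (hA : 0 < A) :
    ∃ C : ℝ, 0 < C ∧ ∃ r₁ : ℝ, ∀ r, r₁ ≤ r → ∀ Λ : Set G, IsRieszSequence π g Λ A B → ∀ x : G,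
      countingRatio μ Λ (closure (oball d r)) x
        ≤ ENNReal.ofReal (formalDegree π μ * (1 + C * r ^ (-(α * δ / (δ + α))))) := by
  obtain ⟨hpos, -⟩ := hπ.lintegral_coeff
  rcases eq_or_ne g 0 with rfl | hg
  -- For g = 0 the lower Riesz bound leaves only Λ = ∅.
  · refine ⟨1, one_pos, 0, fun r _ Λ hR x => ?_⟩
    have h0 : ((Λ ∩ x • closure (oball d r)).encard : ℝ≥0∞) ≤ ENNReal.ofReal 0 := by
      refine encard_le_of_forall_finset fun S _ => ?_
      have h1 := hR.finset_bound S fun _ => 1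
      simp only [map_zero, smul_zero, Finset.sum_const_zero, norm_zero, zero_pow two_ne_zero,
        norm_one, one_pow, Finset.sum_const, nsmul_eq_mul, mul_one] at h1
      exact nonpos_of_mul_nonpos_right h1 hA
    rw [ENNReal.ofReal_zero] at h0
    rw [countingRatio, nonpos_iff_eq_zero.1 h0, ENNReal.zero_div]
    exact zero_le
  obtain ⟨hδ0, hδ1, c, hc, hann⟩ := hδ
  obtain ⟨ρ, hρ, hρn⟩ := hd.exists_oball_mem_nhds
  obtain ⟨C₁, hC₁, hmain⟩ := exists_riesz_card_bound (B := B) hπ hd hg hQ hα hgQ hA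
  obtain ⟨r₁, hr₁, hscale⟩ := exists_radius_scale hα hδ0 hδ1 ρ
    (κ := 1 / (2 * (2 * c + C₁))) (by positivity)
  refine ⟨2 * (2 * c + C₁), by positivity, max r₁ ρ, fun r hr Λ hR x => ?_⟩
  obtain ⟨s, hs, hρs, hsr, hsα, hsmall, hsδ⟩ := hscale r ((le_max_left _ _).trans hr)
  have hr0 : 1 ≤ r := hr₁.trans ((le_max_left _ _).trans hr)
  set q := r ^ (-(α * δ / (δ + α)))
  have hq0 : 0 ≤ q := by positivity
  have hm0 : μ (closure (oball d r)) ≠ 0 :=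
    measure_closure_oball_ne_zero hρn ((le_max_right _ _).trans hr)
  have hsub := hd.closure_oball_subset hρn r
  have hm : μ (closure (oball d r)) ≠ ⊤ :=
    ((measure_mono hsub).trans_lt (hd.measure_oball_lt_top μ _)).ne
  rw [countingRatio, ENNReal.div_le_iff hm0 hm, ← ofReal_measureReal hm,
    ← ENNReal.ofReal_mul (by positivity)]
  refine encard_le_of_forall_finset fun S hS => ?_
  have h1 := hmain Λ hR x (r + ρ) s hs S fun l hl =>
    (mem_smul_oball hd x l _).1 (Set.smul_set_mono hsub (hS l hl))
  rw [hsα] at h1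
  have h2 := AnnularDecay.real_le hd hc hann (r := r + ρ + s) (s := s + ρ) (by linarith)
    (by linarith) (by linarith)
  rw [show r + ρ + s - (s + ρ) = r by ring] at h2
  have h3 := hsδ (r + ρ + s) (s + ρ) (by linarith) (by linarith) (by linarith)
  set V := μ.real (oball d (r + ρ + s))
  set K := μ.real (closure (oball d r))
  have hV0 : 0 ≤ V := measureReal_nonneg
  have hrK : μ.real (oball d r) ≤ K := measureReal_mono subset_closure hm
  have h4 : V * (1 - 2 * c * q) ≤ K := by
    refine le_trans (mul_le_mul_of_nonneg_left ?_ hV0) (h2.trans hrK)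
    nlinarith
  have h5 : (2 * c + C₁) * q ≤ 1 / 2 := by
    have := mul_le_mul_of_nonneg_left hsmall (show 0 ≤ 2 * c + C₁ by positivity)
    refine this.trans_eq ?_
    field_simp
  set a := 2 * c * q
  set b := C₁ * q
  have ha : 0 ≤ a := by positivity
  have hb : 0 ≤ b := by positivity
  have hab : a + b ≤ 1 / 2 := by simp only [a, b]; linarith
  have hD := hpos
  set D := formalDegree π μ
  have h6 : (S.card : ℝ) * (1 - (a + b)) ≤ D * K := by
    calc (S.card : ℝ) * (1 - (a + b)) ≤ S.card * (1 - b) * (1 - a) := by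
          nlinarith [mul_nonneg (Nat.cast_nonneg (α := ℝ) S.card) (mul_nonneg ha hb)]
      _ ≤ D * V * (1 - a) := mul_le_mul_of_nonneg_right h1 (by linarith)
      _ = D * (V * (1 - a)) := mul_assoc _ _ _
      _ ≤ D * K := mul_le_mul_of_nonneg_left h4 hD.le
  have hK0 : 0 ≤ D * K := mul_nonneg hD.le measureReal_nonneg
  have h7 : D * (1 + 2 * (2 * c + C₁) * q) * K = D * K * (1 + 2 * (a + b)) := by
    simp only [a, b]
    ring
  rw [h7]
  have h8 : 1 ≤ (1 - (a + b)) * (1 + 2 * (a + b)) := by nlinarith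
  refine le_of_mul_le_mul_right ?_ (show 0 < 1 - (a + b) by linarith)
  nlinarith [mul_le_mul_of_nonneg_left h8 hK0]

end Density

end CoherentSystem

/-! ### The main theorem. -/

open CoherentSystem in
theorem theorem4p4
    {G : Type*} [Group G] [TopologicalSpace G] [IsTopologicalGroup G] [T2Space G]
    [LocallyCompactSpace G] [SecondCountableTopology G] [MeasurableSpace G] [BorelSpace G]
    (μ : Measure G) [μ.IsHaarMeasure] [μ.IsMulRightInvariant]
    {H : Type*} [NormedAddCommGroup H] [InnerProductSpace ℂ H] [CompleteSpace H]
    [TopologicalSpace.SeparableSpace H]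
    (π : ProjectiveRep G H) (hπ : IsDiscreteSeries π μ)
    (D : ℝ) (hG : HasPolynomialGrowth μ D)
    (d : G → G → ℝ) (hd : IsPeriodicMetric d)
    (δ : ℝ) (hδ : AnnularDecay μ d δ)
    (α : ℝ) (hα : 0 < α) (g : H) :
    -- polynomial decay of the matrix coefficient implies `g ∈ 𝓓_{π,w_α}`
    (∀ C₀ β : ℝ, 0 < C₀ → 1 - δ < β →
      (∀ x : G, ‖coeff π g g x‖ ≤ C₀ * (1 + d x 1) ^ (-((D + α + β) / 2))) →
      ∀ Q : Set G, IsAdmissibleNhd Q → g ∈ localizedVectors π μ Q (polyWeight d α)) ∧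
    -- frames
    ((∃ Q : Set G, IsAdmissibleNhd Q ∧ g ∈ localizedVectors π μ Q (polyWeight d α)) →
      ∀ A B : ℝ, 0 < A → 0 < B → ∃ C : ℝ, 0 < C ∧
        ∀ r : ℕ → ℝ, IsAssociatedRadii d r → ∃ N : ℕ,
          ∀ Λ : Set G, IsFrame π g Λ A B → ∀ n ≥ N,
            ENNReal.ofReal (formalDegree π μ * (1 - C * r n ^ (-(α * δ / (δ + α)))))
              ≤ ⨅ x : G, countingRatio μ Λ (closure (oball d (r n))) x) ∧
    -- Riesz sequences
    ((∃ Q : Set G, IsAdmissibleNhd Q ∧ g ∈ localizedVectors π μ Q (polyWeight d α)) →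
      ∀ A B : ℝ, 0 < A → 0 < B → ∃ C : ℝ, 0 < C ∧
        ∀ r : ℕ → ℝ, IsAssociatedRadii d r → ∃ N : ℕ,
          ∀ Λ : Set G, IsRieszSequence π g Λ A B → ∀ n ≥ N,
            ⨆ x : G, countingRatio μ Λ (closure (oball d (r n))) x
              ≤ ENNReal.ofReal (formalDegree π μ * (1 + C * r n ^ (-(α * δ / (δ + α)))))) := by
  have := isInvInvariant_of_unimodular μ
  refine ⟨fun C₀ β _ hβ h Q hQ => ?_, ?_, ?_⟩
  -- δ ≤ 1 turns β > 1 - δ into β > 0.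
  · exact mem_localizedVectors_of_decay hG hd π hα (by linarith [hδ.2.1]) h hQ
  · rintro ⟨Q, hQ, hgQ⟩ A B hA _
    obtain ⟨C, hC, r₁, h⟩ := frame_density (B := B) hπ hd hδ hQ hα hgQ hA
    refine ⟨C, hC, fun r hr => ?_⟩
    -- The threshold `r₁` is independent of the sequence; only the index at which the radii pass it
    -- depends on `r`.
    obtain ⟨N, hN⟩ := Filter.eventually_atTop.1 (hr.tendsto_atTop.eventually_ge_atTop r₁)
    exact ⟨N, fun Λ hΛ n hn => le_iInf fun x => h (r n) (hN n hn) Λ hΛ x⟩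
  · rintro ⟨Q, hQ, hgQ⟩ A B hA _
    obtain ⟨C, hC, r₁, h⟩ := riesz_density (B := B) hπ hd hδ hQ hα hgQ hA
    refine ⟨C, hC, fun r hr => ?_⟩
    obtain ⟨N, hN⟩ := Filter.eventually_atTop.1 (hr.tendsto_atTop.eventually_ge_atTop r₁)
    exact ⟨N, fun Λ hΛ n hn => iSup_le fun x => h (r n) (hN n hn) Λ hΛ x⟩
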